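/- Points of $\mathbb R^3$ have coordinates $(x,y,z)$, with $z$ vertical. A brick is a cuboid with positive side lengths and edges parallel to the axes. Let a connected solid $P\subset\mathbb R^3$ be partitioned into finitely many (maximal) bricks, any two of which are either disjoint or touch only at the top face of one and the bottom face of the other, in a rectangle called their contact rectangle. A contact rectangle is primitive if it is bordered by exactly one reflex edge, that is, if three of its sides lie on sides of the horizontal faces of both bricks while the fourth lies on a side of only one of the two. If all contact rectangles are primitive, $P$ is a stack. A castle is a stack in which each brick has either zero or two other bricks attached to its top face; its bottom brick is called the base brick. A double castle is the shape obtained by turning a castle upside down and attaching its base brick, via a primitive contact rectangle, to the base brick of another castle lying above it. A reflex edge of $P$ is an edge (a maximal segment) whose interior dihedral angle is $270^\circ$. Two points see each other in $P$ if the segment joining them is contained in $P$. A set of closed (respectively open) reflex edge guards is a set of reflex edges taken with (respectively without) their endpoints; it guards $P$ if each point of $P$ is seen by some point of some guard. **Lemma.** Every double castle has a finite and odd number $r$ of reflex edges, and it can be guarded by at most $\lfloor r/2\rfloor+1$ closed reflex edge guards, and also by at most $\lfloor r/2\rfloor+1$ open reflex edge guards. -/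

import Mathlib

namespace OrthoPoly

open Set Filter Topology

/-- Points of three-dimensional space; coordinate `2` is the vertical one. -/
abbrev Pt : Type := Fin 3 → ℝ

/-- An axis-parallel cuboid, given by its two extreme corners. -/
structure Brick where
  lo : Pt
  hi : Pt
  lo_lt_hi : ∀ i, lo i < hi i

/-- The (closed) solid occupied by a brick. -/
def Brick.solid (B : Brick) : Set Pt := Icc B.lo B.hi

/-- `B.SitsOn A`: the bottom face of `B` and the top face of `A` lie in the same horizontal plane
and meet in a (non-degenerate) rectangle, the contact rectangle of the two bricks. -/
def Brick.SitsOn (B A : Brick) : Prop :=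
  A.hi 2 = B.lo 2 ∧ ∀ i, i ≠ 2 → max (A.lo i) (B.lo i) < min (A.hi i) (B.hi i)

/-- The horizontal rectangle of `B` is obtained from that of `A` by pushing exactly one of the four
sides strictly inwards: the other three sides are flush. -/
def Brick.NarrowerThan (B A : Brick) : Prop :=
  ∃ i j : Fin 3, i ≠ 2 ∧ j ≠ 2 ∧ i ≠ j ∧
    B.lo j = A.lo j ∧ B.hi j = A.hi j ∧
    ((B.lo i = A.lo i ∧ B.hi i < A.hi i) ∨ (A.lo i < B.lo i ∧ B.hi i = A.hi i))

/-- `B` sits on `A` through a primitive contact rectangle, that is, one bordered by exactly one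
reflex edge: three of its sides are flush with both bricks, and the fourth side is
a side of only one of the two bricks (the upper or the lower one). -/
def PrimitiveContact (A B : Brick) : Prop :=
  B.SitsOn A ∧ (B.NarrowerThan A ∨ A.NarrowerThan B)

/-- `Q` is the partition into bricks of the connected solid `P`, all of whose reflex edges are
horizontal. -/
structure IsBrickPartition (P : Set Pt) (Q : Set Brick) : Prop where
  finite : Q.Finite
  union_eq : ⋃ B ∈ Q, B.solid = P
  connected : IsConnected P
  touch : ∀ A ∈ Q, ∀ B ∈ Q, A ≠ B → Disjoint A.solid B.solid ∨ B.SitsOn A ∨ A.SitsOn B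
  maximal : ∀ A ∈ Q, ∀ B ∈ Q, B.SitsOn A → ∃ i, i ≠ 2 ∧ (B.lo i ≠ A.lo i ∨ B.hi i ≠ A.hi i)

/-- `P`, with brick partition `Q`, is a stack: all its contact rectangles are primitive. At any
point at most two bricks of a stack meet, and they do so along a primitive contact rectangle,
so a stack is always a 3-manifold with boundary. -/
structure IsStack (P : Set Pt) (Q : Set Brick) : Prop extends IsBrickPartition P Q where
  primitive : ∀ A ∈ Q, ∀ B ∈ Q, B.SitsOn A → PrimitiveContact A B

/-- `P`, with brick partition `Q`, is a castle: a stack in which either zero or two bricks are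
attached to the top face of each brick. -/
structure IsCastle (P : Set Pt) (Q : Set Brick) : Prop extends IsStack P Q where
  zero_or_two : ∀ A ∈ Q, {B ∈ Q | B.SitsOn A}.ncard = 0 ∨ {B ∈ Q | B.SitsOn A}.ncard = 2

/-- `B` is a bottom brick of the collection `Q` (in a castle there is only one). -/
def IsBaseBrick (Q : Set Brick) (B : Brick) : Prop :=
  B ∈ Q ∧ ∀ A ∈ Q, B.lo 2 ≤ A.lo 2

/-- Turning a point upside down: the rotation by a half turn about the axis of
coordinate `0`. -/
def turn (p : Pt) : Pt := ![p 0, -p 1, -p 2]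

/-- Turning a brick upside down. -/
def Brick.turn (B : Brick) : Brick where
  lo := ![B.lo 0, -B.hi 1, -B.hi 2]
  hi := ![B.hi 0, -B.lo 1, -B.lo 2]
  lo_lt_hi := by
    intro i
    fin_cases i
    · simpa using B.lo_lt_hi 0
    · simpa using B.lo_lt_hi 1
    · simpa using B.lo_lt_hi 2

/-- The two operations called `turn` agree. -/
theorem Brick.solid_turn (B : Brick) : B.turn.solid = OrthoPoly.turn '' B.solid := by
  ext p
  simp only [Brick.solid, Brick.turn, mem_image, mem_Icc, Pi.le_def, Fin.forall_fin_succ,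
    IsEmpty.forall_iff, and_true]
  constructor
  · rintro h
    refine ⟨OrthoPoly.turn p, ?_, ?_⟩
    · simp [OrthoPoly.turn] at h ⊢
      refine ⟨⟨?_, ?_, ?_⟩, ?_, ?_, ?_⟩ <;> linarith
    · ext i
      fin_cases i <;> simp [OrthoPoly.turn]
  · rintro ⟨q, h, rfl⟩
    simp [OrthoPoly.turn] at h ⊢
    refine ⟨⟨?_, ?_, ?_⟩, ?_, ?_, ?_⟩ <;> linarith

/-- A double castle: a castle `C₂`, turned upside down, and a castle `C₁` above it, whose base bricks
are attached to each other via a primitive contact rectangle. -/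
def IsDoubleCastle (D : Set Pt) : Prop :=
  ∃ (C₁ C₂ : Set Pt) (Q₁ Q₂ : Set Brick) (B₁ B₂ : Brick),
    IsCastle C₁ Q₁ ∧ IsBaseBrick Q₁ B₁ ∧ IsCastle C₂ Q₂ ∧ IsBaseBrick Q₂ B₂ ∧
    PrimitiveContact B₂.turn B₁ ∧ D = C₁ ∪ turn '' C₂

/-- Near `p`, the solid `P` is the complement of an open quadrant times a line in direction `i`:
`p` is interior to an edge in direction `i` with interior dihedral angle of 270 degrees. -/
def IsReflexPoint (P : Set Pt) (i : Fin 3) (p : Pt) : Prop :=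
  ∃ σ : Fin 3 → ℝ, (∀ j, σ j ≠ 0) ∧
    ∀ᶠ q in 𝓝 p, (q ∈ P ↔ ∃ j, j ≠ i ∧ σ j * (q j - p j) ≤ 0)

/-- The reflex edges of `P`: maximal segments of reflex points, each given by its endpoints, listed
in increasing order of the coordinate in which they differ. -/
def reflexEdges (P : Set Pt) : Set (Pt × Pt) :=
  {e | ∃ i, e.1 i < e.2 i ∧ (∀ j, j ≠ i → e.1 j = e.2 j) ∧
    (∀ p ∈ openSegment ℝ e.1 e.2, IsReflexPoint P i p) ∧
    ¬ IsReflexPoint P i e.1 ∧ ¬ IsReflexPoint P i e.2}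

/-- Two points see each other within `P` if the segment joining them is contained in `P`. -/
def Sees (P : Set Pt) (x y : Pt) : Prop := segment ℝ x y ⊆ P

/-- The closed edge guards in `G` (segments with their endpoints) guard all of `P`. -/
def GuardedByClosed (P : Set Pt) (G : Set (Pt × Pt)) : Prop :=
  ∀ y ∈ P, ∃ e ∈ G, ∃ x ∈ segment ℝ e.1 e.2, Sees P x y

/-- The open edge guards in `G` (segments without their endpoints) guard all of `P`. -/
def GuardedByOpen (P : Set Pt) (G : Set (Pt × Pt)) : Prop :=
  ∀ y ∈ P, ∃ e ∈ G, ∃ x ∈ openSegment ℝ e.1 e.2, Sees P x y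

end OrthoPoly

namespace OrthoPoly

open Set Filter Topology

/-! Reflex edges correspond one-to-one to contact rectangles (`PrimitiveFamily.mem_reflexEdges_iff`,
`PrimitiveFamily.ncard_reflexEdges`). By connectedness a castle is a binary tree of bricks
(`IsCastle.brickTree`); with `k` inner nodes it has `2 * k` contacts. A double castle with `k₁` and
`k₂` inner nodes therefore has `r = 2 * (k₁ + k₂) + 1` reflex edges, and the bound to reach is `k₁ +
k₂ + 1`.

The guards come from inductions on `Castle`, where the ambient solid `D` and the edge set `E` stay
fixed while subtrees are cut off or stretched. A line of lights along a side of the base reduces the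
cost of a castle to `k` edges: at each inner node at most one new edge is needed
(`Castle.lit_of_side`). A line perpendicular to the castle's own base edge also reduces it to `k`
(`Castle.lit_of_cross`).

For a double castle (`Castle.lit_double`), let `e` be the edge of the contact between the bases; it
is a side of the narrower base. If the wider base carries no bricks, `e` serves both castles. If it
carries two bricks whose edges are perpendicular to `e`, then `e` crosses both and
`Castle.lit_of_cross` applies to each. If those edges are parallel to `e`, the child on the flush
side of the narrower base lies opposite that base: the far child is guarded separately from its own
edge, which also sees the wider base, and the near child forms with the other castle a smaller
double castle, to which induction applies.

Only relative interiors of edges are ever used as lights, so one construction settles open guards,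
and closed guards follow. -/

/-! ### Horizontal segments, boxes and illumination. -/

/-- The point of the horizontal line in direction `j` at height `z` and offset `v`, with
coordinate `t` along the line. -/
def linePt (j : Fin 3) (v z t : ℝ) : Pt := fun n => if n = 2 then z else if n = j then t else v

/-- A horizontal segment in direction `j`. -/
def lineEdge (j : Fin 3) (v z a b : ℝ) : Pt × Pt := (linePt j v z a, linePt j v z b)

theorem linePt_two (j : Fin 3) (v z t : ℝ) : linePt j v z t 2 = z := by simp [linePt]

theorem linePt_dir {j : Fin 3} (hj : j ≠ 2) (v z t : ℝ) : linePt j v z t j = t := by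
  simp [linePt, hj]

theorem linePt_off {i j : Fin 3} (hi : i ≠ 2) (hij : i ≠ j) (v z t : ℝ) :
    linePt j v z t i = v := by
  simp [linePt, hi, hij]

theorem eq_or_eq_of_ne_two {i j n : Fin 3} (hi : i ≠ 2) (hj : j ≠ 2) (hij : i ≠ j)
    (hn : n ≠ 2) : n = i ∨ n = j := by
  revert i j n; decide

theorem eq_linePt {i j : Fin 3} (hi : i ≠ 2) (hj : j ≠ 2) (hij : i ≠ j) {p : Pt} {v z t : ℝ}
    (h1 : p i = v) (h2 : p j = t) (h3 : p 2 = z) : p = linePt j v z t := by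
  ext n
  by_cases hn : n = 2
  · subst hn; rw [linePt_two, h3]
  · rcases eq_or_eq_of_ne_two hi hj hij hn with rfl | rfl
    · rw [linePt_off hi hij, h1]
    · rw [linePt_dir hj, h2]

theorem openSegment_linePt (j : Fin 3) (v z : ℝ) {a b : ℝ} (hab : a < b) :
    openSegment ℝ (linePt j v z a) (linePt j v z b) = linePt j v z '' Ioo a b := by
  have key : ∀ u w : ℝ, u + w = 1 →
      u • linePt j v z a + w • linePt j v z b = linePt j v z (u * a + w * b) := by
    intro u w huw
    ext n
    simp only [linePt, Pi.add_apply, Pi.smul_apply, smul_eq_mul]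
    split_ifs
    · rw [← add_mul, huw, one_mul]
    · rfl
    · rw [← add_mul, huw, one_mul]
  rw [← openSegment_eq_Ioo hab]
  ext p
  constructor
  · rintro ⟨u, w, hu, hw, huw, rfl⟩
    exact ⟨u * a + w * b, ⟨u, w, hu, hw, huw, rfl⟩, (key u w huw).symm⟩
  · rintro ⟨t, ⟨u, w, hu, hw, huw, rfl⟩, rfl⟩
    exact ⟨u, w, hu, hw, huw, key u w huw⟩

/-- The box over the horizontal rectangle of `l` and `h` between the heights `a` and `b`, where
heights are measured upwards if `s = 1` and downwards if `s = -1`. -/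
def box (s : ℝ) (l h : Pt) (a b : ℝ) : Set Pt :=
  {p | (∀ n, n ≠ 2 → l n ≤ p n ∧ p n ≤ h n) ∧ a ≤ s * p 2 ∧ s * p 2 ≤ b}

theorem convex_box (s : ℝ) (l h : Pt) (a b : ℝ) : Convex ℝ (box s l h a b) := by
  rintro p ⟨hp, hp'⟩ q ⟨hq, hq'⟩ u w hu hw huw
  refine ⟨fun n hn => (convex_Icc (l n) (h n)) (hp n hn) (hq n hn) hu hw huw, ?_⟩
  have := (convex_Icc a b) hp' hq' hu hw huw
  have e : s * (u • p + w • q) 2 = u • (s * p 2) + w • (s * q 2) := by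
    simp only [Pi.add_apply, Pi.smul_apply, smul_eq_mul]; ring
  rw [e]
  exact this

theorem box_mono {s a b a' b' : ℝ} {l h l' h' : Pt}
    (hr : ∀ n, n ≠ 2 → l' n ≤ l n ∧ h n ≤ h' n) (ha : a' ≤ a) (hb : b ≤ b') :
    box s l h a b ⊆ box s l' h' a' b' := fun _ hp =>
  ⟨fun n hn => ⟨(hr n hn).1.trans (hp.1 n hn).1, (hp.1 n hn).2.trans (hr n hn).2⟩,
    ha.trans hp.2.1, hp.2.2.trans hb⟩

theorem box_subset_union (s : ℝ) (l h : Pt) (a b c : ℝ) :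
    box s l h a c ⊆ box s l h a b ∪ box s l h b c := by
  intro p hp
  rcases le_total (s * p 2) b with hb | hb
  · exact Or.inl ⟨hp.1, hp.2.1, hb⟩
  · exact Or.inr ⟨hp.1, hb, hp.2.2⟩

/-- Each point of `S` is seen, within `D`, by a point of `L`. -/
def Lit (D L S : Set Pt) : Prop := ∀ p ∈ S, ∃ x ∈ L, Sees D x p

/-- The points of the open segments in `G`. -/
def edgePts (G : Set (Pt × Pt)) : Set Pt := {x | ∃ e ∈ G, x ∈ openSegment ℝ e.1 e.2}

theorem Lit.mono {D L L' S S' : Set Pt} (H : Lit D L S) (hL : L ⊆ L') (hS : S' ⊆ S) :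
    Lit D L' S' := fun p hp =>
  let ⟨x, hx, h⟩ := H p (hS hp)
  ⟨x, hL hx, h⟩

theorem Lit.union {D L S S' : Set Pt} (H : Lit D L S) (H' : Lit D L S') : Lit D L (S ∪ S') :=
  fun p hp => hp.elim (H p) (H' p)

theorem Convex.lit {D L K : Set Pt} (hK : Convex ℝ K) (hD : K ⊆ D) {x : Pt} (hx : x ∈ K)
    (hL : x ∈ L) : Lit D L K := fun _ hp => ⟨x, hL, (hK.segment_subset hx hp).trans hD⟩

theorem edgePts_mono {G G' : Set (Pt × Pt)} (h : G ⊆ G') : edgePts G ⊆ edgePts G' :=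
  fun _ ⟨e, he, hx⟩ => ⟨e, h he, hx⟩

theorem linePt_mem_edgePts {G : Set (Pt × Pt)} {j : Fin 3} {v z a b t : ℝ}
    (h : lineEdge j v z a b ∈ G) (ht : t ∈ Ioo a b) : linePt j v z t ∈ edgePts G :=
  ⟨_, h, by
    rw [lineEdge, openSegment_linePt j v z (ht.1.trans ht.2)]
    exact ⟨t, ht, rfl⟩⟩

/-! ### Castles as trees of boxes, and the cost of guarding one. -/

/-- A castle in `D`, described as a binary tree of boxes: `l` and `h` span the rectangle of its base
brick, `a` is the height of its bottom (measured upwards for `s = 1` and downwards for `s = -1`),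
`S` is the solid and `k` the number of bricks to which two further bricks are attached. The reflex
edges belong to `E`. -/
inductive Castle (D : Set Pt) (E : Set (Pt × Pt)) (s : ℝ) : Pt → Pt → ℝ → Set Pt → ℕ → Prop
  | leaf {l h : Pt} {a b : ℝ} (hlt : ∀ n, n ≠ 2 → l n < h n) (hab : a < b)
      (hD : box s l h a b ⊆ D) : Castle D E s l h a (box s l h a b) 0
  | node {l h l₁ h₁ l₂ h₂ : Pt} {a b : ℝ} {S₁ S₂ : Set Pt} {k₁ k₂ : ℕ} {i j : Fin 3}
      (hlt : ∀ n, n ≠ 2 → l n < h n) (hab : a < b) (hD : box s l h a b ⊆ D)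
      (hi : i ≠ 2) (hj : j ≠ 2) (hij : i ≠ j)
      (hl₁ : l₁ j = l j) (hh₁ : h₁ j = h j) (hl₂ : l₂ j = l j) (hh₂ : h₂ j = h j)
      (hl : l₁ i = l i) (hh : h₂ i = h i) (hgap : h₁ i < l₂ i)
      (he₁ : lineEdge j (h₁ i) (s * b) (l j) (h j) ∈ E)
      (he₂ : lineEdge j (l₂ i) (s * b) (l j) (h j) ∈ E)
      (H₁ : Castle D E s l₁ h₁ b S₁ k₁) (H₂ : Castle D E s l₂ h₂ b S₂ k₂) :
      Castle D E s l h a (box s l h a b ∪ S₁ ∪ S₂) (k₁ + k₂ + 1)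

section

variable {D : Set Pt} {E : Set (Pt × Pt)} {s : ℝ} {l h : Pt} {a : ℝ} {S : Set Pt} {k : ℕ}

theorem Castle.lt (H : Castle D E s l h a S k) : ∀ n, n ≠ 2 → l n < h n := by
  cases H with
  | leaf hlt => exact hlt
  | node hlt => exact hlt

theorem Castle.base (H : Castle D E s l h a S k) :
    ∃ b, a < b ∧ box s l h a b ⊆ D ∧ box s l h a b ⊆ S := by
  cases H with
  | leaf _ hab hD => exact ⟨_, hab, hD, subset_rfl⟩
  | node _ hab hD => exact ⟨_, hab, hD, fun _ h => Or.inl (Or.inl h)⟩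

/-- Lowering the bottom face of a castle. -/
theorem Castle.stretch (H : Castle D E s l h a S k) {a' : ℝ} (ha : a' ≤ a)
    (hD' : box s l h a' a ⊆ D) : ∃ S', S ⊆ S' ∧ Castle D E s l h a' S' k := by
  cases H with
  | leaf hlt hab hD =>
    exact ⟨_, box_mono (fun _ _ => ⟨le_rfl, le_rfl⟩) ha le_rfl,
      .leaf hlt (ha.trans_lt hab) ((box_subset_union ..).trans (union_subset hD' hD))⟩
  | node hlt hab hD hi hj hij hl₁ hh₁ hl₂ hh₂ hl hh hgap he₁ he₂ H₁ H₂ =>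
    exact ⟨_, union_subset_union_left _ (union_subset_union_left _
        (box_mono (fun _ _ => ⟨le_rfl, le_rfl⟩) ha le_rfl)),
      .node hlt (ha.trans_lt hab) ((box_subset_union ..).trans (union_subset hD' hD))
      hi hj hij hl₁ hh₁ hl₂ hh₂ hl hh hgap he₁ he₂ H₁ H₂⟩

/-- A box is convex, so one point of the line inside it is enough; an interior parameter is chosen
so that open edges qualify. -/
theorem lit_box_of_line (hs : s * s = 1) {a b c v : ℝ} {i j : Fin 3} {L : Set Pt}
    (hi : i ≠ 2) (hj : j ≠ 2) (hij : i ≠ j) (hlt : ∀ n, n ≠ 2 → l n < h n)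
    (hD : box s l h a b ⊆ D) (hac : a ≤ c) (hcb : c ≤ b) (hv : l i ≤ v ∧ v ≤ h i)
    (hL : ∀ t ∈ Ioo (l j) (h j), linePt j v (s * c) t ∈ L) :
    Lit D L (box s l h a b) := by
  obtain ⟨t, ht⟩ := exists_between (hlt j hj)
  refine Convex.lit (convex_box ..) hD (x := linePt j v (s * c) t) ⟨?_, ?_⟩ (hL t ht)
  · intro n hn
    rcases eq_or_eq_of_ne_two hi hj hij hn with rfl | rfl
    · rw [linePt_off hi hij]; exact hv
    · rw [linePt_dir hj]; exact ⟨ht.1.le, ht.2.le⟩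
  · rw [linePt_two, ← mul_assoc, hs, one_mul]; exact ⟨hac, hcb⟩

theorem ncard_union_le_add {α : Type*} {G₁ G₂ : Set α} {m n : ℕ} (h₁ : G₁.ncard ≤ m)
    (h₂ : G₂.ncard ≤ n) : (G₁ ∪ G₂).ncard ≤ m + n :=
  (ncard_union_le _ _).trans (add_le_add h₁ h₂)

theorem ncard_insert_union_le {α : Type*} {G₁ G₂ : Set α} {m n : ℕ} (e : α) (h₁ : G₁.ncard ≤ m)
    (h₂ : G₂.ncard ≤ n) : (insert e (G₁ ∪ G₂)).ncard ≤ m + n + 1 :=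
  (ncard_insert_le _ _).trans (Nat.succ_le_succ (ncard_union_le_add h₁ h₂))

/-- A castle is guarded by a line of lights along a side of the bottom face of its base brick,
possibly below it, together with `k` of its reflex edges. -/
theorem Castle.lit_of_side (hs : s * s = 1) (H : Castle D E s l h a S k) :
    ∀ {a' v : ℝ} {i j : Fin 3} {L : Set Pt}, a' ≤ a → box s l h a' a ⊆ D →
      i ≠ 2 → j ≠ 2 → i ≠ j → (v = l i ∨ v = h i) →
      (∀ t ∈ Ioo (l j) (h j), linePt j v (s * a') t ∈ L) →
      ∃ G ⊆ E, G.ncard ≤ k ∧ Lit D (L ∪ edgePts G) (box s l h a' a ∪ S) := by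
  induction H with
  | @leaf l h a b hlt hab hD =>
    intro a' v i j L ha hD' hi hj hij hv hL
    have hD'' : box s l h a' b ⊆ D := (box_subset_union ..).trans (union_subset hD' hD)
    refine ⟨∅, empty_subset _, by simp, ?_⟩
    have hv' : l i ≤ v ∧ v ≤ h i := by
      have := (hlt i hi).le
      rcases hv with rfl | rfl <;> simp [this]
    refine (lit_box_of_line hs hi hj hij hlt hD'' le_rfl (ha.trans hab.le) hv' hL).mono
      subset_union_left (union_subset ?_ ?_)
    · exact box_mono (fun _ _ => ⟨le_rfl, le_rfl⟩) le_rfl hab.le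
    · exact box_mono (fun _ _ => ⟨le_rfl, le_rfl⟩) ha le_rfl
  | @node l h l₁ h₁ l₂ h₂ a b S₁ S₂ k₁ k₂ i₀ j₀ hlt hab hD hi₀ hj₀ hij₀ hl₁ hh₁ hl₂ hh₂ hl hh
      hgap he₁ he₂ H₁ H₂ ih₁ ih₂ =>
    intro a' v i j L ha hD' hi hj hij hv hL
    have hD'' : box s l h a' b ⊆ D := (box_subset_union ..).trans (union_subset hD' hD)
    have hv' : l i ≤ v ∧ v ≤ h i := by
      have := (hlt i hi).le
      rcases hv with rfl | rfl <;> simp [this]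
    have hbase := lit_box_of_line hs hi hj hij hlt hD'' le_rfl (ha.trans hab.le) hv' hL
    have hsub : box s l h a' a ∪ box s l h a b ⊆ box s l h a' b := union_subset
      (box_mono (fun _ _ => ⟨le_rfl, le_rfl⟩) le_rfl hab.le)
      (box_mono (fun _ _ => ⟨le_rfl, le_rfl⟩) ha le_rfl)
    have hr₁ : ∀ n, n ≠ 2 → l n ≤ l₁ n ∧ h₁ n ≤ h n := by
      intro n hn
      have := H₂.lt i₀ hi₀
      rcases eq_or_eq_of_ne_two hi₀ hj₀ hij₀ hn with rfl | rfl <;> constructor <;> linarith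
    have hr₂ : ∀ n, n ≠ 2 → l n ≤ l₂ n ∧ h₂ n ≤ h n := by
      intro n hn
      have := H₁.lt i₀ hi₀
      rcases eq_or_eq_of_ne_two hi₀ hj₀ hij₀ hn with rfl | rfl <;> constructor <;> linarith
    have hb₁ : box s l₁ h₁ a' b ⊆ D := (box_mono hr₁ le_rfl le_rfl).trans hD''
    have hb₂ : box s l₂ h₂ a' b ⊆ D := (box_mono hr₂ le_rfl le_rfl).trans hD''
    have ha' : a' ≤ b := ha.trans hab.le
    -- If the lights run across the gap between the two children, the portion under each child
    -- follows a side of that child's base, and the node costs no edge. Otherwise they run parallel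
    -- to the gap.
    rcases eq_or_eq_of_ne_two hi₀ hj₀ hij₀ hj with rfl | rfl
    · obtain rfl : i = j₀ := (eq_or_eq_of_ne_two hi₀ hj₀ hij₀ hi).resolve_left hij
      obtain ⟨G₁, hG₁, hc₁, hlit₁⟩ := ih₁ ha' hb₁ hi hj hij (v := v) (L := L)
        (by rw [hl₁, hh₁]; exact hv)
        (fun t ht => hL t ⟨(hr₁ _ hj).1.trans_lt ht.1, ht.2.trans_le (hr₁ _ hj).2⟩)
      obtain ⟨G₂, hG₂, hc₂, hlit₂⟩ := ih₂ ha' hb₂ hi hj hij (v := v) (L := L)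
        (by rw [hl₂, hh₂]; exact hv)
        (fun t ht => hL t ⟨(hr₂ _ hj).1.trans_lt ht.1, ht.2.trans_le (hr₂ _ hj).2⟩)
      refine ⟨G₁ ∪ G₂, union_subset hG₁ hG₂,
        (ncard_union_le_add hc₁ hc₂).trans (Nat.le_succ _), ?_⟩
      rw [← union_assoc, ← union_assoc]
      refine ((hbase.mono subset_union_left hsub).union (hlit₁.mono
        (union_subset_union_right _ (edgePts_mono subset_union_left)) subset_union_right)).union
        (hlit₂.mono (union_subset_union_right _ (edgePts_mono subset_union_right))
          subset_union_right)
    · obtain rfl : i = i₀ := (eq_or_eq_of_ne_two hi₀ hj₀ hij₀ hi).resolve_right hij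
      have hb₁' : box s l₁ h₁ b b ⊆ D :=
        (box_mono (fun _ _ => ⟨le_rfl, le_rfl⟩) ha' le_rfl).trans hb₁
      have hb₂' : box s l₂ h₂ b b ⊆ D :=
        (box_mono (fun _ _ => ⟨le_rfl, le_rfl⟩) ha' le_rfl).trans hb₂
      -- The child flush with the lit side inherits the lights; the other one starts from its own
      -- edge, which is the extra unit at this node.
      rcases hv with hv | hv
      · obtain ⟨G₁, hG₁, hc₁, hlit₁⟩ := ih₁ ha' hb₁ hi hj hij (v := v) (L := L)
          (by rw [hl]; exact Or.inl hv) (by rw [hl₁, hh₁]; exact hL)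
        obtain ⟨G₂, hG₂, hc₂, hlit₂⟩ := ih₂ le_rfl hb₂' hi hj hij (v := l₂ i)
          (L := edgePts {lineEdge j (l₂ i) (s * b) (l j) (h j)}) (Or.inl rfl)
          (by rw [hl₂, hh₂]; exact fun t ht => linePt_mem_edgePts rfl ht)
        refine ⟨insert (lineEdge j (l₂ i) (s * b) (l j) (h j)) (G₁ ∪ G₂),
          insert_subset he₂ (union_subset hG₁ hG₂), ncard_insert_union_le _ hc₁ hc₂, ?_⟩
        rw [← union_assoc, ← union_assoc]
        refine ((hbase.mono subset_union_left hsub).union (hlit₁.mono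
          (union_subset_union_right _ (edgePts_mono ?_)) subset_union_right)).union
          (hlit₂.mono (union_subset ?_ ?_) subset_union_right)
        · exact subset_union_left.trans (subset_insert _ _)
        · exact (edgePts_mono (by simp)).trans subset_union_right
        · exact (edgePts_mono (subset_union_right.trans (subset_insert _ _))).trans
            subset_union_right
      · obtain ⟨G₂, hG₂, hc₂, hlit₂⟩ := ih₂ ha' hb₂ hi hj hij (v := v) (L := L)
          (by rw [hh]; exact Or.inr hv) (by rw [hl₂, hh₂]; exact hL)
        obtain ⟨G₁, hG₁, hc₁, hlit₁⟩ := ih₁ le_rfl hb₁' hi hj hij (v := h₁ i)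
          (L := edgePts {lineEdge j (h₁ i) (s * b) (l j) (h j)}) (Or.inr rfl)
          (by rw [hl₁, hh₁]; exact fun t ht => linePt_mem_edgePts rfl ht)
        refine ⟨insert (lineEdge j (h₁ i) (s * b) (l j) (h j)) (G₁ ∪ G₂),
          insert_subset he₁ (union_subset hG₁ hG₂), ncard_insert_union_le _ hc₁ hc₂, ?_⟩
        rw [← union_assoc, ← union_assoc]
        refine ((hbase.mono subset_union_left hsub).union
          (hlit₁.mono (union_subset ?_ ?_) subset_union_right)).union (hlit₂.mono
          (union_subset_union_right _ (edgePts_mono ?_)) subset_union_right)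
        · exact (edgePts_mono (by simp)).trans subset_union_right
        · exact (edgePts_mono (subset_union_left.trans (subset_insert _ _))).trans
            subset_union_right
        · exact subset_union_right.trans (subset_insert _ _)

/-- A castle whose base brick is attached below along one of its reflex edges is guarded by this
edge and `k` others. -/
theorem Castle.lit_of_own_edge (hs : s * s = 1) (H : Castle D E s l h a S k) {v : ℝ}
    {i j : Fin 3} (hi : i ≠ 2) (hj : j ≠ 2) (hij : i ≠ j) (hv : v = l i ∨ v = h i)
    (he : lineEdge j v (s * a) (l j) (h j) ∈ E) :
    ∃ G ⊆ E, lineEdge j v (s * a) (l j) (h j) ∈ G ∧ G.ncard ≤ k + 1 ∧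
      Lit D (edgePts G) S := by
  obtain ⟨b, hab, hD, -⟩ := H.base
  obtain ⟨G, hG, hc, hlit⟩ := H.lit_of_side hs le_rfl
    ((box_mono (fun _ _ => ⟨le_rfl, le_rfl⟩) le_rfl hab.le).trans hD) hi hj hij hv
    (L := edgePts {lineEdge j v (s * a) (l j) (h j)}) (fun t ht => linePt_mem_edgePts rfl ht)
  refine ⟨insert _ G, insert_subset he hG, mem_insert _ _,
    (ncard_insert_le _ _).trans (Nat.succ_le_succ hc), hlit.mono (union_subset ?_ ?_)
    subset_union_right⟩
  · exact edgePts_mono (by simp)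
  · exact edgePts_mono (subset_insert _ _)

/-- A castle whose base brick is attached below along one of its reflex edges is guarded by a line
of lights perpendicular to this edge, crossing the bottom face of the base brick from side to side
and possibly below it, together with `k` reflex edges. -/
theorem Castle.lit_of_cross (hs : s * s = 1) (H : Castle D E s l h a S k) :
    ∀ {a' v w : ℝ} {i j : Fin 3} {L : Set Pt}, a' ≤ a → box s l h a' a ⊆ D →
      i ≠ 2 → j ≠ 2 → i ≠ j → (l i ≤ v ∧ v ≤ h i) →
      (∀ t ∈ Ioo (l j) (h j), linePt j v (s * a') t ∈ L) →
      (w = l j ∨ w = h j) → lineEdge i w (s * a) (l i) (h i) ∈ E →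
      ∃ G ⊆ E, G.ncard ≤ k ∧ Lit D (L ∪ edgePts G) (box s l h a' a ∪ S) := by
  induction H with
  | @leaf l h a b hlt hab hD =>
    intro a' v w i j L ha hD' hi hj hij hv hL hw he
    have hD'' : box s l h a' b ⊆ D := (box_subset_union ..).trans (union_subset hD' hD)
    refine ⟨∅, empty_subset _, by simp, ?_⟩
    refine (lit_box_of_line hs hi hj hij hlt hD'' le_rfl (ha.trans hab.le) hv hL).mono
      subset_union_left (union_subset ?_ ?_)
    · exact box_mono (fun _ _ => ⟨le_rfl, le_rfl⟩) le_rfl hab.le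
    · exact box_mono (fun _ _ => ⟨le_rfl, le_rfl⟩) ha le_rfl
  | @node l h l₁ h₁ l₂ h₂ a b S₁ S₂ k₁ k₂ i₀ j₀ hlt hab hD hi₀ hj₀ hij₀ hl₁ hh₁ hl₂ hh₂ hl hh
      hgap he₁ he₂ H₁ H₂ ih₁ ih₂ =>
    intro a' v w i j L ha hD' hi hj hij hv hL hw he
    have hD'' : box s l h a' b ⊆ D := (box_subset_union ..).trans (union_subset hD' hD)
    have hbase := lit_box_of_line hs hi hj hij hlt hD'' le_rfl (ha.trans hab.le) hv hL
    have hsub : box s l h a' a ∪ box s l h a b ⊆ box s l h a' b := union_subset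
      (box_mono (fun _ _ => ⟨le_rfl, le_rfl⟩) le_rfl hab.le)
      (box_mono (fun _ _ => ⟨le_rfl, le_rfl⟩) ha le_rfl)
    have hr₁ : ∀ n, n ≠ 2 → l n ≤ l₁ n ∧ h₁ n ≤ h n := by
      intro n hn
      have := H₂.lt i₀ hi₀
      rcases eq_or_eq_of_ne_two hi₀ hj₀ hij₀ hn with rfl | rfl <;> constructor <;> linarith
    have hr₂ : ∀ n, n ≠ 2 → l n ≤ l₂ n ∧ h₂ n ≤ h n := by
      intro n hn
      have := H₁.lt i₀ hi₀
      rcases eq_or_eq_of_ne_two hi₀ hj₀ hij₀ hn with rfl | rfl <;> constructor <;> linarith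
    have hb₁ : box s l₁ h₁ a' b ⊆ D := (box_mono hr₁ le_rfl le_rfl).trans hD''
    have hb₂ : box s l₂ h₂ a' b ⊆ D := (box_mono hr₂ le_rfl le_rfl).trans hD''
    have ha' : a' ≤ b := ha.trans hab.le
    -- If the children are separated along the line, it crosses both of them, and each child's own
    -- edge is perpendicular to it, so the hypotheses recur.
    rcases eq_or_eq_of_ne_two hi₀ hj₀ hij₀ hj with rfl | rfl
    · obtain rfl : i = j₀ := (eq_or_eq_of_ne_two hi₀ hj₀ hij₀ hi).resolve_left hij
      obtain ⟨G₁, hG₁, hc₁, hlit₁⟩ := ih₁ ha' hb₁ hi hj hij (v := v) (L := L)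
        (by rw [hl₁, hh₁]; exact hv)
        (fun t ht => hL t ⟨(hr₁ _ hj).1.trans_lt ht.1, ht.2.trans_le (hr₁ _ hj).2⟩)
        (Or.inr rfl) (by rw [hl₁, hh₁]; exact he₁)
      obtain ⟨G₂, hG₂, hc₂, hlit₂⟩ := ih₂ ha' hb₂ hi hj hij (v := v) (L := L)
        (by rw [hl₂, hh₂]; exact hv)
        (fun t ht => hL t ⟨(hr₂ _ hj).1.trans_lt ht.1, ht.2.trans_le (hr₂ _ hj).2⟩)
        (Or.inl rfl) (by rw [hl₂, hh₂]; exact he₂)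
      refine ⟨G₁ ∪ G₂, union_subset hG₁ hG₂,
        (ncard_union_le_add hc₁ hc₂).trans (Nat.le_succ _), ?_⟩
      rw [← union_assoc, ← union_assoc]
      refine ((hbase.mono subset_union_left hsub).union (hlit₁.mono
        (union_subset_union_right _ (edgePts_mono subset_union_left)) subset_union_right)).union
        (hlit₂.mono (union_subset_union_right _ (edgePts_mono subset_union_right))
          subset_union_right)
    · obtain rfl : i = i₀ := (eq_or_eq_of_ne_two hi₀ hj₀ hij₀ hi).resolve_right hij
      -- Here the line is parallel to the gap and may lie inside it, missing both children. The
      -- base's own edge runs across the gap and follows a side of each child, so this single edge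
      -- serves both through `Castle.lit_of_side`.
      have hL' : ∀ t ∈ Ioo (l i) (h i),
          linePt i w (s * a) t ∈ edgePts {lineEdge i w (s * a) (l i) (h i)} :=
        fun t ht => linePt_mem_edgePts rfl ht
      obtain ⟨G₁, hG₁, hc₁, hlit₁⟩ := H₁.lit_of_side hs hab.le
        ((box_mono (fun _ _ => ⟨le_rfl, le_rfl⟩) ha le_rfl).trans hb₁) hj hi hij.symm
        (by rw [hl₁, hh₁]; exact hw)
        (fun t ht => hL' t ⟨(hr₁ _ hi).1.trans_lt ht.1, ht.2.trans_le (hr₁ _ hi).2⟩)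
      obtain ⟨G₂, hG₂, hc₂, hlit₂⟩ := H₂.lit_of_side hs hab.le
        ((box_mono (fun _ _ => ⟨le_rfl, le_rfl⟩) ha le_rfl).trans hb₂) hj hi hij.symm
        (by rw [hl₂, hh₂]; exact hw)
        (fun t ht => hL' t ⟨(hr₂ _ hi).1.trans_lt ht.1, ht.2.trans_le (hr₂ _ hi).2⟩)
      refine ⟨insert (lineEdge i w (s * a) (l i) (h i)) (G₁ ∪ G₂),
        insert_subset he (union_subset hG₁ hG₂), ncard_insert_union_le _ hc₁ hc₂, ?_⟩
      rw [← union_assoc, ← union_assoc]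
      refine ((hbase.mono subset_union_left hsub).union
        (hlit₁.mono (union_subset ?_ ?_) subset_union_right)).union
        (hlit₂.mono (union_subset ?_ ?_) subset_union_right)
      · exact (edgePts_mono (by simp)).trans subset_union_right
      · exact (edgePts_mono (subset_union_left.trans (subset_insert _ _))).trans
          subset_union_right
      · exact (edgePts_mono (by simp)).trans subset_union_right
      · exact (edgePts_mono (subset_union_right.trans (subset_insert _ _))).trans
          subset_union_right

/-! ### Guarding two castles joined at their bases. -/

/-- In direction `i`, the rectangle of `l` and `h` is that of `l'` and `h'` with one side pushed
(weakly) inwards, to `v`. -/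
def Narrower (i : Fin 3) (l h l' h' : Pt) (v : ℝ) : Prop :=
  (l i = l' i ∧ h i ≤ h' i ∧ v = h i) ∨ (l' i ≤ l i ∧ h i = h' i ∧ v = l i)

theorem Narrower.mem {i : Fin 3} {l h l' h' : Pt} {v : ℝ} (H : Narrower i l h l' h' v)
    (hlt : l i < h i) :
    (v = l i ∨ v = h i) ∧ (l' i ≤ v ∧ v ≤ h' i) ∧ l' i ≤ l i ∧ h i ≤ h' i := by
  rcases H with ⟨h1, h2, rfl⟩ | ⟨h1, h2, rfl⟩
  · exact ⟨Or.inr rfl, ⟨by linarith, h2⟩, h1.ge, h2⟩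
  · exact ⟨Or.inl rfl, ⟨h1, by linarith⟩, h1, h2.le⟩

/-- Two castles attached to each other at their base bricks, one turned upside down, are guarded by
`k + k' + 1` of their reflex edges. -/
theorem Castle.lit_double (n : ℕ) : ∀ {s a a' v : ℝ} {i j : Fin 3} {l h l' h' : Pt} {S S' : Set Pt}
    {k k' : ℕ}, k + k' = n → s * s = 1 → Castle D E s l h a S k → Castle D E (-s) l' h' a' S' k' →
    a' = -a → i ≠ 2 → j ≠ 2 → i ≠ j → l j = l' j → h j = h' j → Narrower i l h l' h' v →
    lineEdge j v (s * a) (l j) (h j) ∈ E →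
    ∃ G ⊆ E, G.ncard ≤ k + k' + 1 ∧ Lit D (edgePts G) (S ∪ S') := by
  induction n using Nat.strong_induction_on with
  | _ n IH =>
  intro s a a' v i j l h l' h' S S' k k' hn hs H H' ha' hi hj hij hl hh hN he
  have hs' : (-s) * (-s) = 1 := by rw [neg_mul_neg, hs]
  obtain ⟨hv, hv', hi₁, hi₂⟩ := hN.mem (H.lt i hi)
  have hsa : (-s) * a' = s * a := by rw [ha', neg_mul_neg]
  have hLe : ∀ t ∈ Ioo (l' j) (h' j),
      linePt j v ((-s) * a') t ∈ edgePts {lineEdge j v (s * a) (l j) (h j)} := by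
    rw [hsa, ← hl, ← hh]; exact fun t ht => linePt_mem_edgePts rfl ht
  have hU := H.lit_of_own_edge hs hi hj hij hv he
  cases H' with
  -- The contact edge lies on the face of the lone wider brick, hence sees all of it.
  | @leaf _ _ _ b hlt hab hD =>
    obtain ⟨G, hG, heG, hc, hlit⟩ := hU
    exact ⟨G, hG, hc, hlit.union ((lit_box_of_line hs' hi hj hij hlt hD le_rfl hab.le hv' hLe).mono
      (edgePts_mono (by simpa using heG)) subset_rfl)⟩
  | @node _ _ l₁ h₁ l₂ h₂ _ b S₁ S₂ k₁ k₂ i₀ j₀ hlt hab hD hi₀ hj₀ hij₀ hl₁ hh₁ hl₂ hh₂ hl₀ hh₀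
      hgap he₁ he₂ H₁ H₂ =>
    have hr₁ : ∀ n, n ≠ 2 → l' n ≤ l₁ n ∧ h₁ n ≤ h' n := by
      intro n hn
      have := H₂.lt i₀ hi₀
      rcases eq_or_eq_of_ne_two hi₀ hj₀ hij₀ hn with rfl | rfl <;> constructor <;> linarith
    have hr₂ : ∀ n, n ≠ 2 → l' n ≤ l₂ n ∧ h₂ n ≤ h' n := by
      intro n hn
      have := H₁.lt i₀ hi₀
      rcases eq_or_eq_of_ne_two hi₀ hj₀ hij₀ hn with rfl | rfl <;> constructor <;> linarith
    have hb₁ : box (-s) l₁ h₁ a' b ⊆ D := (box_mono hr₁ le_rfl le_rfl).trans hD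
    have hb₂ : box (-s) l₂ h₂ a' b ⊆ D := (box_mono hr₂ le_rfl le_rfl).trans hD
    -- First case: the children's edges are perpendicular to the contact edge, which therefore
    -- crosses both children.
    rcases eq_or_eq_of_ne_two hi₀ hj₀ hij₀ hj with rfl | rfl
    · obtain rfl : i = j₀ := (eq_or_eq_of_ne_two hi₀ hj₀ hij₀ hi).resolve_left hij
      obtain ⟨G, hG, heG, hc, hlit⟩ := hU
      have hbase := lit_box_of_line hs' hi hj hij hlt hD le_rfl hab.le hv' hLe
      obtain ⟨G₁, hG₁, hc₁, hlit₁⟩ := H₁.lit_of_cross hs' hab.le hb₁ hi hj hij (v := v)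
        (by rw [hl₁, hh₁]; exact hv')
        (fun t ht => hLe t ⟨(hr₁ _ hj).1.trans_lt ht.1, ht.2.trans_le (hr₁ _ hj).2⟩)
        (Or.inr rfl) (by rw [hl₁, hh₁]; exact he₁)
      obtain ⟨G₂, hG₂, hc₂, hlit₂⟩ := H₂.lit_of_cross hs' hab.le hb₂ hi hj hij (v := v)
        (by rw [hl₂, hh₂]; exact hv')
        (fun t ht => hLe t ⟨(hr₂ _ hj).1.trans_lt ht.1, ht.2.trans_le (hr₂ _ hj).2⟩)
        (Or.inl rfl) (by rw [hl₂, hh₂]; exact he₂)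
      have heG' := singleton_subset_iff.2 heG
      refine ⟨G ∪ (G₁ ∪ G₂), union_subset hG (union_subset hG₁ hG₂),
        (ncard_union_le_add hc (ncard_union_le_add hc₁ hc₂)).trans (by omega), ?_⟩
      refine (hlit.mono (edgePts_mono subset_union_left) subset_rfl).union
        (((hbase.mono (edgePts_mono (heG'.trans subset_union_left)) subset_rfl).union
          (hlit₁.mono (union_subset ?_ ?_) subset_union_right)).union
          (hlit₂.mono (union_subset ?_ ?_) subset_union_right))
      · exact edgePts_mono (heG'.trans subset_union_left)
      · exact edgePts_mono (subset_union_left.trans subset_union_right)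
      · exact edgePts_mono (heG'.trans subset_union_left)
      · exact edgePts_mono (subset_union_right.trans subset_union_right)
    · obtain rfl : i = i₀ := (eq_or_eq_of_ne_two hi₀ hj₀ hij₀ hi).resolve_right hij
      -- The suffix `c` marks the child close to the narrower base, flush with it on one side, and
      -- `f` the far child. The far child with its own edge costs `kf + 1`, and that edge also sees
      -- the wider base; there remain `k + kc + 1` edges for the castle `H` and the close child.
      have step : ∀ {lc hc lf hf : Pt} {Sc Sf : Set Pt} {kc kf : ℕ} {vc vf : ℝ},
          kc + kf + 1 = k₁ + k₂ + 1 →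
          Castle D E (-s) lc hc b Sc kc → Castle D E (-s) lf hf b Sf kf →
          lc j = l' j → hc j = h' j → lf j = l' j → hf j = h' j →
          box (-s) lc hc a' b ⊆ D →
          (Narrower i l h lc hc v ∨ Narrower i lc hc l h vc) →
          (vf = lf i ∨ vf = hf i) → (l' i ≤ vf ∧ vf ≤ h' i) →
          lineEdge j vc ((-s) * b) (l' j) (h' j) ∈ E → lineEdge j vf ((-s) * b) (l' j) (h' j) ∈ E →
          ∃ G ⊆ E, G.ncard ≤ k + (kc + kf + 1) + 1 ∧
            Lit D (edgePts G) (S ∪ (box (-s) l' h' a' b ∪ Sc ∪ Sf)) := by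
        intro lc hc lf hf Sc Sf kc kf vc vf hk Hc Hf hlc hhc hlf hhf hbc hcase hvf hvf' hec hef
        obtain ⟨Gf, hGf, hefG, hcf, hlitf⟩ := Hf.lit_of_own_edge hs' hi hj hij hvf
          (by rw [hlf, hhf]; exact hef)
        have hbase : Lit D (edgePts Gf) (box (-s) l' h' a' b) :=
          lit_box_of_line hs' hi hj hij hlt hD hab.le le_rfl hvf' (fun t ht =>
            linePt_mem_edgePts hefG (by rw [hlf, hhf]; exact ht))
        have fin : (∃ G ⊆ E, G.ncard ≤ k + kc + 1 ∧ Lit D (edgePts G) (S ∪ Sc)) →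
            ∃ G ⊆ E, G.ncard ≤ k + (kc + kf + 1) + 1 ∧
            Lit D (edgePts G) (S ∪ (box (-s) l' h' a' b ∪ Sc ∪ Sf)) := by
          rintro ⟨G, hG, hcG, hlit⟩
          refine ⟨G ∪ Gf, union_subset hG hGf, (ncard_union_le_add hcG hcf).trans (by omega), ?_⟩
          have hl1 := edgePts_mono (subset_union_left : G ⊆ G ∪ Gf)
          have hl2 := edgePts_mono (subset_union_right : Gf ⊆ G ∪ Gf)
          exact (hlit.mono hl1 subset_union_left).union
            (((hbase.mono hl2 subset_rfl).union (hlit.mono hl1 subset_union_right)).union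
              (hlitf.mono hl2 subset_rfl))
        apply fin
        -- The narrower of the two remaining castles keeps its base edge; the other is stretched
        -- through the discarded base brick until they meet. If the close child is the narrower one,
        -- the roles and the sign `s` are exchanged.
        rcases hcase with hcase | hcase
        · obtain ⟨Sc', hSc, Hc'⟩ := Hc.stretch hab.le hbc
          obtain ⟨G, hG, hcG, hlit⟩ := IH (k + kc) (by omega) rfl hs H Hc' ha' hi hj hij
            (hl.trans hlc.symm) (hh.trans hhc.symm) hcase he
          exact ⟨G, hG, hcG, hlit.mono subset_rfl (union_subset_union_right _ hSc)⟩
        · have hb : box s l h (-b) a ⊆ D := by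
            refine Subset.trans ?_ hD
            intro p hp
            refine ⟨fun n hn => ?_, ?_, ?_⟩
            · have := hp.1 n hn
              rcases eq_or_eq_of_ne_two hi hj hij hn with rfl | rfl <;> constructor <;> linarith
            · have := hp.2.2; linarith
            · have := hp.2.1; linarith
          obtain ⟨S'', hS'', H''⟩ := H.stretch (a' := -b) (by linarith) hb
          rw [← neg_neg s] at H''
          obtain ⟨G, hG, hcG, hlit⟩ := IH (kc + k) (by omega) rfl hs' Hc H'' rfl hi hj hij
            (hlc.trans hl.symm) (hhc.trans hh.symm) hcase (by rw [hlc, hhc]; exact hec)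
          refine ⟨G, hG, by omega, hlit.mono subset_rfl ?_⟩
          rw [union_comm]
          exact union_subset_union_right _ hS''
      have hlt₁ := H₁.lt i hi
      have hlt₂ := H₂.lt i hi
      rcases hN with ⟨h1, h2, h3⟩ | ⟨h1, h2, h3⟩
      · refine step (vc := h₁ i) (vf := l₂ i) rfl H₁ H₂ hl₁ hh₁ hl₂ hh₂ hb₁ ?_ (Or.inl rfl)
          ⟨by linarith, by linarith⟩ he₁ he₂
        -- The two footprints may coincide, so `Narrower` has to allow equality.
        rcases le_total (h i) (h₁ i) with hc | hc
        · exact Or.inl (Or.inl ⟨by linarith, hc, h3⟩)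
        · exact Or.inr (Or.inl ⟨by linarith, hc, rfl⟩)
      · have := step (vc := l₂ i) (vf := h₁ i) (by omega) H₂ H₁ hl₂ hh₂ hl₁ hh₁ hb₂ ?_
          (Or.inr rfl) ⟨by linarith, by linarith⟩ he₂ he₁
        · rwa [union_right_comm, add_comm k₁ k₂]
        rcases le_total (l₂ i) (l i) with hc | hc
        · exact Or.inl (Or.inr ⟨hc, by linarith, h3⟩)
        · exact Or.inr (Or.inr ⟨hc, by linarith, rfl⟩)

end

/-! ### Reflex edges correspond to contact rectangles. -/

theorem exists_radius {p : Pt} {F : Pt → Prop} (H : ∀ᶠ q in 𝓝 p, F q) :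
    ∃ ε > 0, ∀ q : Pt, (∀ n, |q n - p n| ≤ ε) → F q := by
  obtain ⟨ε, hε, h⟩ := Metric.eventually_nhds_iff.1 H
  refine ⟨ε / 2, half_pos hε, fun q hq => h ?_⟩
  refine lt_of_le_of_lt ((dist_pi_le_iff (half_pos hε).le).2 fun n => ?_) (half_lt_self hε)
  rw [Real.dist_eq]
  exact hq n

theorem Brick.mem_solid {B : Brick} {i j : Fin 3} (hi : i ≠ 2) (hj : j ≠ 2) (hij : i ≠ j)
    {q : Pt} : q ∈ B.solid ↔
      (B.lo i ≤ q i ∧ q i ≤ B.hi i) ∧ (B.lo j ≤ q j ∧ q j ≤ B.hi j) ∧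
        (B.lo 2 ≤ q 2 ∧ q 2 ≤ B.hi 2) := by
  constructor
  · intro h
    exact ⟨⟨h.1 i, h.2 i⟩, ⟨h.1 j, h.2 j⟩, ⟨h.1 2, h.2 2⟩⟩
  · rintro ⟨h1, h2, h3⟩
    have : ∀ n, B.lo n ≤ q n ∧ q n ≤ B.hi n := by
      intro n
      by_cases hn : n = 2
      · rw [hn]; exact h3
      · rcases eq_or_eq_of_ne_two hi hj hij hn with rfl | rfl
        · exact h1
        · exact h2
    exact ⟨fun n => (this n).1, fun n => (this n).2⟩

theorem Brick.mem_solid_iff {B : Brick} {q : Pt} :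
    q ∈ B.solid ↔ ∀ n, B.lo n ≤ q n ∧ q n ≤ B.hi n :=
  ⟨fun h n => ⟨h.1 n, h.2 n⟩, fun h => ⟨fun n => (h n).1, fun n => (h n).2⟩⟩

theorem exists_ne_ne (k n : Fin 3) : ∃ m, m ≠ k ∧ m ≠ n := by
  revert k n; decide

/-- A finite set of bricks, any two of which are disjoint or attached to each other via a primitive
contact rectangle. -/
structure PrimitiveFamily (Q : Set Brick) : Prop where
  finite : Q.Finite
  touch : ∀ A ∈ Q, ∀ B ∈ Q, A ≠ B → Disjoint A.solid B.solid ∨ B.SitsOn A ∨ A.SitsOn B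
  primitive : ∀ A ∈ Q, ∀ B ∈ Q, B.SitsOn A → PrimitiveContact A B

/-- The rectangles of `A` and `B` agree in direction `j`, and in direction `i` they share exactly
one side, `v` being the position of the side bordering the intersection on the other end. -/
def ContactData (A B : Brick) (i j : Fin 3) (v : ℝ) : Prop :=
  i ≠ 2 ∧ j ≠ 2 ∧ i ≠ j ∧ A.lo j = B.lo j ∧ A.hi j = B.hi j ∧
    ((A.lo i = B.lo i ∧ A.hi i ≠ B.hi i ∧ v = min (A.hi i) (B.hi i)) ∨
      (A.hi i = B.hi i ∧ A.lo i ≠ B.lo i ∧ v = max (A.lo i) (B.lo i)))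

/-- `e` is the reflex edge bordering the contact rectangle of `A` and the brick `B` above it. -/
def IsContactEdge (A B : Brick) (e : Pt × Pt) : Prop :=
  ∃ i j v, ContactData A B i j v ∧ e = lineEdge j v (A.hi 2) (A.lo j) (A.hi j)

theorem PrimitiveContact.exists_contactData {A B : Brick} (H : PrimitiveContact A B) :
    ∃ i j v, ContactData A B i j v := by
  obtain ⟨-, ⟨i, j, hi, hj, hij, h1, h2, h3⟩ | ⟨i, j, hi, hj, hij, h1, h2, h3⟩⟩ := H
  · rcases h3 with ⟨h3, h4⟩ | ⟨h3, h4⟩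
    · exact ⟨i, j, _, hi, hj, hij, h1.symm, h2.symm, Or.inl ⟨h3.symm, h4.ne', rfl⟩⟩
    · exact ⟨i, j, _, hi, hj, hij, h1.symm, h2.symm, Or.inr ⟨h4.symm, h3.ne, rfl⟩⟩
  · rcases h3 with ⟨h3, h4⟩ | ⟨h3, h4⟩
    · exact ⟨i, j, _, hi, hj, hij, h1, h2, Or.inl ⟨h3, h4.ne, rfl⟩⟩
    · exact ⟨i, j, _, hi, hj, hij, h1, h2, Or.inr ⟨h4, h3.ne', rfl⟩⟩

/-- The direction in which the rectangles differ is determined by them, and in it exactly one side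
is flush. -/
theorem IsContactEdge.unique {A B : Brick} {e e' : Pt × Pt} (H : IsContactEdge A B e)
    (H' : IsContactEdge A B e') : e = e' := by
  obtain ⟨i, j, v, ⟨hi, hj, hij, h1, h2, h3⟩, rfl⟩ := H
  obtain ⟨i', j', v', ⟨hi', hj', hij', h1', h2', h3'⟩, rfl⟩ := H'
  rcases eq_or_eq_of_ne_two hi hj hij hi' with rfl | rfl
  · obtain rfl := (eq_or_eq_of_ne_two hi hj hij hj').resolve_left hij'.symm
    have : v = v' := by
      rcases h3 with ⟨a, b, rfl⟩ | ⟨a, b, rfl⟩ <;> rcases h3' with ⟨a', b', rfl⟩ | ⟨a', b', rfl⟩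
      · rfl
      · exact absurd a b'
      · exact absurd a b'
      · rfl
    rw [this]
  · rcases h3' with ⟨a', b', -⟩ | ⟨a', b', -⟩
    · exact absurd h2 b'
    · exact absurd h1 b'

section

variable {Q : Set Brick}

theorem eventually_near_bricks (hQ : Q.Finite) (p : Pt) :
    ∀ᶠ q in 𝓝 p, ∀ A ∈ Q, (q ∈ A.solid → p ∈ A.solid) ∧
      ∀ n, (p n < A.hi n → q n < A.hi n) ∧ (A.lo n < p n → A.lo n < q n) := by
  refine (eventually_all_finite hQ).2 fun A _ => Filter.Eventually.and ?_ ?_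
  · by_cases hp : p ∈ A.solid
    · exact Eventually.of_forall fun _ _ => hp
    · have : IsClosed A.solid := isClosed_Icc
      filter_upwards [this.isOpen_compl.mem_nhds hp] with q hq hq'
      exact absurd hq' hq
  · refine eventually_all.2 fun n => Filter.Eventually.and ?_ ?_
    · by_cases hp : p n < A.hi n
      · filter_upwards [(continuous_apply n).continuousAt.eventually_lt continuousAt_const hp]
          with q hq _ using hq
      · exact Eventually.of_forall fun _ h => absurd h hp
    · by_cases hp : A.lo n < p n
      · filter_upwards [continuousAt_const.eventually_lt (continuous_apply n).continuousAt hp]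
          with q hq _ using hq
      · exact Eventually.of_forall fun _ h => absurd h hp

theorem PrimitiveFamily.sitsOn_of_mem (hQ : PrimitiveFamily Q) {A B : Brick} (hA : A ∈ Q)
    (hB : B ∈ Q) (hAB : A ≠ B) {p : Pt} (hpA : p ∈ A.solid) (hpB : p ∈ B.solid) :
    B.SitsOn A ∨ A.SitsOn B :=
  (hQ.touch A hA B hB hAB).resolve_left fun h => disjoint_left.1 h hpA hpB

theorem Brick.SitsOn.ne {A B : Brick} (h : B.SitsOn A) : A ≠ B := by
  rintro rfl
  exact (A.lo_lt_hi 2).ne' h.1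

/-- At most two bricks meet at a point. -/
theorem PrimitiveFamily.eq_or_eq_of_mem (hQ : PrimitiveFamily Q) {A B C : Brick} (hA : A ∈ Q)
    (hB : B ∈ Q) (hC : C ∈ Q) (h : B.SitsOn A) {p : Pt} (hpA : p ∈ A.solid) (hpB : p ∈ B.solid)
    (hpC : p ∈ C.solid) : C = A ∨ C = B := by
  by_contra! hne
  have hAB := h.1
  have h1 := hpA.2 2
  have h2 := hpB.1 2
  have h3 := A.lo_lt_hi 2
  have h4 := B.lo_lt_hi 2
  have h5 := C.lo_lt_hi 2
  rcases hQ.sitsOn_of_mem hC hA hne.1 hpC hpA with hc | hc <;>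
  rcases hQ.sitsOn_of_mem hC hB hne.2 hpC hpB with hc' | hc' <;>
  · have := hc.1
    have := hc'.1
    linarith

/-- Points displaced from `p` along one axis stay in the solid, while a diagonal displacement `b`
into the removed quadrant leaves it. A single brick cannot do this, so two bricks meet at `p`; for
these two, `b` is outside only if `p` lies on the edge bordering their contact. -/
theorem PrimitiveFamily.exists_contact_of_isReflexPoint (hQ : PrimitiveFamily Q) {k : Fin 3}
    {p : Pt} (H : IsReflexPoint (⋃ B ∈ Q, B.solid) k p) :
    ∃ A ∈ Q, ∃ B ∈ Q, B.SitsOn A ∧ p ∈ A.solid ∧ p ∈ B.solid ∧ ∃ i v, ContactData A B i k v ∧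
      p i = v ∧ p 2 = A.hi 2 ∧ A.lo k < p k ∧ p k < A.hi k := by
  obtain ⟨σ, hσ, H⟩ := H
  obtain ⟨ε, hε, H⟩ := exists_radius (H.and (eventually_near_bricks hQ.finite p))
  simp only [mem_iUnion, exists_prop] at H
  -- Some coordinate other than `k` and `n` is unchanged, and it satisfies the reflex condition with
  -- value zero.
  have haxis : ∀ n δ, |δ| ≤ ε → ∃ B ∈ Q, p ∈ B.solid ∧ Function.update p n (p n + δ) ∈ B.solid := by
    intro n δ hδ
    obtain ⟨H1, H2⟩ := H (Function.update p n (p n + δ)) (by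
      intro m
      by_cases hm : m = n
      · subst hm; simpa using hδ
      · simpa [hm] using hε.le)
    obtain ⟨m, hmk, hmn⟩ := exists_ne_ne k n
    obtain ⟨B, hB, hqB⟩ := H1.2 ⟨m, hmk, by simp [hmn]⟩
    exact ⟨B, hB, (H2 B hB).1 hqB, hqB⟩
  obtain ⟨b, hbk, hbσ, hbε⟩ : ∃ b : Pt, b k = p k ∧ (∀ n, n ≠ k → 0 < σ n * (b n - p n)) ∧
      ∀ n, |b n - p n| ≤ ε := by
    refine ⟨fun n => if n = k then p n else if 0 < σ n then p n + ε else p n - ε, by simp, ?_, ?_⟩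
    · intro n hn
      by_cases h : 0 < σ n
      · simp [hn, h, hε]
      · have : σ n < 0 := lt_of_le_of_ne (not_lt.1 h) (hσ n)
        simp only [hn, h, if_false]
        nlinarith
    · intro n
      dsimp only
      split_ifs <;> simp [abs_of_pos hε, hε.le]
  have hb : ∀ B ∈ Q, b ∉ B.solid := by
    intro B hB hbB
    obtain ⟨j, hj, hj'⟩ := (H b hbε).1.1 ⟨B, hB, hbB⟩
    exact absurd (hbσ j hj) (not_lt.2 hj')
  have hnear := (H b hbε).2
  obtain ⟨A₀, hA₀, hpA₀, -⟩ := haxis 0 0 (by simpa using hε.le)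
  have hup : |ε| ≤ ε := (abs_of_pos hε).le
  have hdn : |-ε| ≤ ε := by rw [abs_neg]; exact hup
  by_cases hone : ∀ C ∈ Q, p ∈ C.solid → C = A₀
  · exfalso
    refine hb A₀ hA₀ (Brick.mem_solid_iff.2 fun n => ?_)
    obtain ⟨C, hC, hpC, h1⟩ := haxis n ε hup
    obtain ⟨C', hC', hpC', h2⟩ := haxis n (-ε) hdn
    rw [hone C hC hpC] at h1
    rw [hone C' hC' hpC'] at h2
    have h1 := h1.2 n
    have h2 := h2.1 n
    simp only [Function.update_self] at h1 h2
    have := abs_le.1 (hbε n)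
    constructor <;> linarith
  obtain ⟨A, hA, B, hB, hBA, hpA, hpB⟩ : ∃ A ∈ Q, ∃ B ∈ Q, B.SitsOn A ∧ p ∈ A.solid ∧
      p ∈ B.solid := by
    push Not at hone
    obtain ⟨C, hC, hpC, hne⟩ := hone
    rcases hQ.sitsOn_of_mem hC hA₀ hne hpC hpA₀ with h | h
    · exact ⟨C, hC, A₀, hA₀, h, hpC, hpA₀⟩
    · exact ⟨A₀, hA₀, C, hC, h, hpA₀, hpC⟩
  have htwo : ∀ C ∈ Q, p ∈ C.solid → C = A ∨ C = B := fun C hC hpC =>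
    hQ.eq_or_eq_of_mem hA hB hC hBA hpA hpB hpC
  have haxis' : ∀ n δ, |δ| ≤ ε → (A.lo n ≤ p n + δ ∧ p n + δ ≤ A.hi n) ∨
      (B.lo n ≤ p n + δ ∧ p n + δ ≤ B.hi n) := by
    intro n δ hδ
    obtain ⟨C, hC, hpC, h1⟩ := haxis n δ hδ
    have h2 := Brick.mem_solid_iff.1 h1 n
    rw [Function.update_self] at h2
    rcases htwo C hC hpC with rfl | rfl
    · exact Or.inl h2
    · exact Or.inr h2
  obtain ⟨i, j, v, hdata⟩ := (hQ.primitive A hA B hB hBA).exists_contactData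
  have hdata' := hdata
  obtain ⟨hi, hj, hij, hlo, hhi, hv⟩ := hdata
  have hz := hBA.1
  have hp2 : p 2 = A.hi 2 := le_antisymm (hpA.2 2) (by rw [hz]; exact hpB.1 2)
  have hj1 : A.lo j ≤ p j - ε := by
    rcases haxis' j (-ε) hdn with h | h <;> linarith [h.1]
  have hj2 : p j + ε ≤ A.hi j := by
    rcases haxis' j ε hup with h | h <;> linarith [h.2]
  have hbj := abs_le.1 (hbε j)
  have hbA2 := ((hnear A hA).2 2).2 (by rw [hp2]; exact A.lo_lt_hi 2)
  have hbB2 := ((hnear B hB).2 2).1 (by rw [hp2, hz]; exact B.lo_lt_hi 2)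
  -- Otherwise resetting coordinate `j` of `b` to that of `p` would bring it back into the solid;
  -- but the bricks at `p` extend by `ε` both ways in direction `j`, so `b` itself would be inside.
  have hkj : k = j := by
    by_contra hkj
    obtain ⟨H1, H2⟩ := H (Function.update b j (p j)) (by
      intro m
      by_cases hm : m = j
      · subst hm; simpa using hε.le
      · simpa [hm] using hbε m)
    obtain ⟨C, hC, hqC⟩ := H1.2 ⟨j, Ne.symm hkj, by simp⟩
    refine hb C hC ((Brick.mem_solid hi hj hij).2 ?_)
    have hq := (Brick.mem_solid hi hj hij).1 hqC
    rw [Function.update_of_ne hij, Function.update_of_ne hj.symm] at hq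
    refine ⟨hq.1, ?_, hq.2.2⟩
    rcases htwo C hC ((H2 C hC).1 hqC) with rfl | rfl <;> constructor <;> linarith
  subst hkj
  have hbi : ¬ ((A.lo i ≤ b i ∧ b i ≤ A.hi i) ∧ (B.lo i ≤ b i ∧ b i ≤ B.hi i)) := by
    rintro ⟨h1, h2⟩
    rcases le_total (b 2) (p 2) with h | h
    · exact hb A hA ((Brick.mem_solid hi hj hij).2
        ⟨h1, ⟨by linarith, by linarith⟩, hbA2.le, by linarith⟩)
    · exact hb B hB ((Brick.mem_solid hi hj hij).2
        ⟨h2, ⟨by linarith, by linarith⟩, by linarith, hbB2.le⟩)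
  have hbi' := abs_le.1 (hbε i)
  refine ⟨A, hA, B, hB, hBA, hpA, hpB, i, v, hdata', ?_, hp2, by linarith, by linarith⟩
  by_contra hne
  apply hbi
  rcases hv with ⟨h1, -, rfl⟩ | ⟨h1, -, rfl⟩
  · have hlt := lt_min_iff.1 (lt_of_le_of_ne (le_min (hpA.2 i) (hpB.2 i)) hne)
    have h2 := ((hnear A hA).2 i).1 hlt.1
    have h3 := ((hnear B hB).2 i).1 hlt.2
    have h4 : A.lo i ≤ p i - ε := by
      rcases haxis' i (-ε) hdn with h | h <;> linarith [h.1]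
    exact ⟨⟨by linarith, h2.le⟩, ⟨by linarith, h3.le⟩⟩
  · have hlt := max_lt_iff.1 (lt_of_le_of_ne (max_le (hpA.1 i) (hpB.1 i)) (Ne.symm hne))
    have h2 := ((hnear A hA).2 i).2 hlt.1
    have h3 := ((hnear B hB).2 i).2 hlt.2
    have h4 : p i + ε ≤ A.hi i := by
      rcases haxis' i ε hup with h | h <;> linarith [h.2]
    exact ⟨⟨h2.le, by linarith⟩, ⟨h3.le, by linarith⟩⟩

theorem ContactData.mem_solids {A B : Brick} {i j : Fin 3} {v t : ℝ} (hd : ContactData A B i j v)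
    (hBA : B.SitsOn A) (ht : A.lo j ≤ t ∧ t ≤ A.hi j) :
    linePt j v (A.hi 2) t ∈ A.solid ∧ linePt j v (A.hi 2) t ∈ B.solid := by
  obtain ⟨hi, hj, hij, hlo, hhi, hv⟩ := hd
  have ho := hBA.2 i hi
  have h1 := lt_min_iff.1 ((le_max_left _ _).trans_lt ho)
  have h2 := lt_min_iff.1 ((le_max_right _ _).trans_lt ho)
  have hv' : (A.lo i ≤ v ∧ v ≤ A.hi i) ∧ B.lo i ≤ v ∧ v ≤ B.hi i := by
    rcases hv with ⟨-, -, rfl⟩ | ⟨-, -, rfl⟩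
    · exact ⟨⟨(le_min h1.1.le h1.2.le), min_le_left _ _⟩, le_min h2.1.le h2.2.le, min_le_right _ _⟩
    · exact ⟨⟨le_max_left _ _, max_le h1.1.le h2.1.le⟩, le_max_right _ _,
        max_le h1.2.le h2.2.le⟩
  rw [Brick.mem_solid hi hj hij, Brick.mem_solid hi hj hij, linePt_two, linePt_dir hj,
    linePt_off hi hij]
  refine ⟨⟨hv'.1, ht, (A.lo_lt_hi 2).le, le_rfl⟩, hv'.2, by rwa [← hlo, ← hhi], hBA.1.ge, ?_⟩
  rw [hBA.1]
  exact (B.lo_lt_hi 2).le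

theorem PrimitiveFamily.isReflexPoint (hQ : PrimitiveFamily Q) {A B : Brick} (hA : A ∈ Q)
    (hB : B ∈ Q) (hBA : B.SitsOn A) {i j : Fin 3} {v t : ℝ} (hd : ContactData A B i j v)
    (ht : t ∈ Ioo (A.lo j) (A.hi j)) :
    IsReflexPoint (⋃ B ∈ Q, B.solid) j (linePt j v (A.hi 2) t) := by
  obtain ⟨hpA, hpB⟩ := hd.mem_solids hBA ⟨ht.1.le, ht.2.le⟩
  obtain ⟨hi, hj, hij, hlo, hhi, hv⟩ := hd
  have hz := hBA.1
  set p := linePt j v (A.hi 2) t with hp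
  have hpi : p i = v := linePt_off hi hij _ _ _
  have hpj : p j = t := linePt_dir hj _ _ _
  have hp2 : p 2 = A.hi 2 := linePt_two _ _ _ _
  -- Only `A` and `B` matter near `p`. In the four cases below, the sign of `a` tells whether the
  -- lower or the upper brick is the wider one, and that of `b` which side is flush.
  have key : ∀ a b : ℝ, a ≠ 0 → b ≠ 0 → (∀ᶠ q in 𝓝 p, (q ∈ A.solid ∨ q ∈ B.solid ↔
      a * (q 2 - p 2) ≤ 0 ∨ b * (q i - p i) ≤ 0)) →
      IsReflexPoint (⋃ B ∈ Q, B.solid) j p := by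
    intro a b ha hb h
    refine ⟨fun n => if n = 2 then a else if n = i then b else 1, ?_, ?_⟩
    · intro n
      dsimp only
      split_ifs <;> simp [ha, hb]
    · filter_upwards [h, eventually_near_bricks hQ.finite p] with q hq hnear
      have h1 : q ∈ ⋃ B ∈ Q, B.solid ↔ q ∈ A.solid ∨ q ∈ B.solid := by
        simp only [mem_iUnion, exists_prop]
        constructor
        · rintro ⟨C, hC, hqC⟩
          rcases hQ.eq_or_eq_of_mem hA hB hC hBA hpA hpB ((hnear C hC).1 hqC) with rfl | rfl
          · exact Or.inl hqC
          · exact Or.inr hqC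
        · rintro (h | h)
          · exact ⟨A, hA, h⟩
          · exact ⟨B, hB, h⟩
      rw [h1, hq]
      constructor
      · rintro (h | h)
        · exact ⟨2, hj.symm, by simpa using h⟩
        · exact ⟨i, hij, by simpa [hi] using h⟩
      · rintro ⟨n, hn, h⟩
        by_cases hn2 : n = 2
        · subst hn2; left; simpa using h
        · obtain rfl := (eq_or_eq_of_ne_two hi hj hij hn2).resolve_right hn
          right; simpa [hi] using h
  have hnear := eventually_near_bricks hQ.finite p
  have hloA := A.lo_lt_hi i
  have hloB := B.lo_lt_hi i
  have hloA2 := A.lo_lt_hi 2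
  have hloB2 := B.lo_lt_hi 2
  have hfacts : ∀ᶠ q in 𝓝 p, (A.lo j ≤ q j ∧ q j ≤ A.hi j) ∧ A.lo 2 ≤ q 2 ∧ q 2 ≤ B.hi 2 ∧
      (p i < A.hi i → q i < A.hi i) ∧ (p i < B.hi i → q i < B.hi i) ∧
      (A.lo i < p i → A.lo i < q i) ∧ (B.lo i < p i → B.lo i < q i) := by
    filter_upwards [hnear] with q hq
    obtain ⟨-, hqA⟩ := hq A hA
    obtain ⟨-, hqB⟩ := hq B hB
    exact ⟨⟨((hqA j).2 (hpj ▸ ht.1)).le, ((hqA j).1 (hpj ▸ ht.2)).le⟩,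
      ((hqA 2).2 (by linarith)).le, ((hqB 2).1 (by linarith)).le,
      (hqA i).1, (hqB i).1, (hqA i).2, (hqB i).2⟩
  simp only [Brick.mem_solid hi hj hij] at key
  rcases hv with ⟨h1, h2, h3⟩ | ⟨h1, h2, h3⟩
  · rcases lt_or_gt_of_ne h2 with h2 | h2
    · rw [min_eq_left h2.le] at h3
      refine key (-1) 1 (by norm_num) one_ne_zero (hfacts.mono ?_)
      rintro q ⟨⟨f1, f2⟩, f3, f4, f5, f6, f7, f8⟩
      have f6 := f6 (by linarith)
      have f7 := f7 (by linarith)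
      constructor
      · rintro (⟨⟨c1, c2⟩, c3, c4, c5⟩ | ⟨⟨c1, c2⟩, c3, c4, c5⟩)
        · right; linarith
        · left; linarith
      · intro h
        rcases le_or_gt (p 2) (q 2) with h' | h'
        · right; refine ⟨⟨?_, ?_⟩, ⟨?_, ?_⟩, ?_, ?_⟩ <;> linarith
        · have h := h.resolve_left (by linarith)
          left; refine ⟨⟨?_, ?_⟩, ⟨?_, ?_⟩, ?_, ?_⟩ <;> linarith
    · rw [min_eq_right h2.le] at h3
      refine key 1 1 one_ne_zero one_ne_zero (hfacts.mono ?_)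
      rintro q ⟨⟨f1, f2⟩, f3, f4, f5, f6, f7, f8⟩
      have f5 := f5 (by linarith)
      have f7 := f7 (by linarith)
      constructor
      · rintro (⟨⟨c1, c2⟩, c3, c4, c5⟩ | ⟨⟨c1, c2⟩, c3, c4, c5⟩)
        · left; linarith
        · right; linarith
      · intro h
        rcases le_or_gt (q 2) (p 2) with h' | h'
        · left; refine ⟨⟨?_, ?_⟩, ⟨?_, ?_⟩, ?_, ?_⟩ <;> linarith
        · have h := h.resolve_left (by linarith)
          right; refine ⟨⟨?_, ?_⟩, ⟨?_, ?_⟩, ?_, ?_⟩ <;> linarith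
  · rcases lt_or_gt_of_ne h2 with h2 | h2
    · rw [max_eq_right h2.le] at h3
      refine key 1 (-1) one_ne_zero (by norm_num) (hfacts.mono ?_)
      rintro q ⟨⟨f1, f2⟩, f3, f4, f5, f6, f7, f8⟩
      have f5 := f5 (by linarith)
      have f7 := f7 (by linarith)
      constructor
      · rintro (⟨⟨c1, c2⟩, c3, c4, c5⟩ | ⟨⟨c1, c2⟩, c3, c4, c5⟩)
        · left; linarith
        · right; linarith
      · intro h
        rcases le_or_gt (q 2) (p 2) with h' | h'
        · left; refine ⟨⟨?_, ?_⟩, ⟨?_, ?_⟩, ?_, ?_⟩ <;> linarith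
        · have h := h.resolve_left (by linarith)
          right; refine ⟨⟨?_, ?_⟩, ⟨?_, ?_⟩, ?_, ?_⟩ <;> linarith
    · rw [max_eq_left h2.le] at h3
      refine key (-1) (-1) (by norm_num) (by norm_num) (hfacts.mono ?_)
      rintro q ⟨⟨f1, f2⟩, f3, f4, f5, f6, f7, f8⟩
      have f6 := f6 (by linarith)
      have f8 := f8 (by linarith)
      constructor
      · rintro (⟨⟨c1, c2⟩, c3, c4, c5⟩ | ⟨⟨c1, c2⟩, c3, c4, c5⟩)
        · right; linarith
        · left; linarith
      · intro h
        rcases le_or_gt (p 2) (q 2) with h' | h'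
        · right; refine ⟨⟨?_, ?_⟩, ⟨?_, ?_⟩, ?_, ?_⟩ <;> linarith
        · have h := h.resolve_left (by linarith)
          left; refine ⟨⟨?_, ?_⟩, ⟨?_, ?_⟩, ?_, ?_⟩ <;> linarith

/-- The ends of the edge bordering a contact rectangle are not reflex points. -/
theorem PrimitiveFamily.not_isReflexPoint (hQ : PrimitiveFamily Q) {A B : Brick} (hA : A ∈ Q)
    (hB : B ∈ Q) (hBA : B.SitsOn A) {i j : Fin 3} {v t : ℝ} (hd : ContactData A B i j v)
    (ht : t = A.lo j ∨ t = A.hi j) :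
    ¬ IsReflexPoint (⋃ B ∈ Q, B.solid) j (linePt j v (A.hi 2) t) := by
  intro H
  have hlt := A.lo_lt_hi j
  obtain ⟨hpA, hpB⟩ := hd.mem_solids hBA (t := t) (by rcases ht with rfl | rfl <;> simp [hlt.le])
  obtain ⟨A', hA', B', hB', hBA', hpA', hpB', i', v', hd', -, -, h1, h2⟩ :=
    hQ.exists_contact_of_isReflexPoint H
  rw [linePt_dir hd.2.1] at h1 h2
  have : A'.lo j = A.lo j ∧ A'.hi j = A.hi j := by
    rcases hQ.eq_or_eq_of_mem hA hB hA' hBA hpA hpB hpA' with rfl | rfl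
    · exact ⟨rfl, rfl⟩
    · exact ⟨hd.2.2.2.1.symm, hd.2.2.2.2.1.symm⟩
  rcases ht with rfl | rfl
  · exact h1.ne this.1
  · exact h2.ne this.2.symm

/-- The midpoint of a reflex edge selects a contact. Interior points of the contact edge are reflex
and its ends are not, so a maximal reflex segment on that line must end exactly there. -/
theorem PrimitiveFamily.mem_reflexEdges_iff (hQ : PrimitiveFamily Q) (e : Pt × Pt) :
    e ∈ reflexEdges (⋃ B ∈ Q, B.solid) ↔
      ∃ A ∈ Q, ∃ B ∈ Q, B.SitsOn A ∧ IsContactEdge A B e := by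
  constructor
  · rintro ⟨k, hlt, hflat, hopen, hn1, hn2⟩
    have hmid := hopen ((1 / 2 : ℝ) • e.1 + (1 / 2 : ℝ) • e.2)
      ⟨1 / 2, 1 / 2, by norm_num, by norm_num, by norm_num, rfl⟩
    obtain ⟨A, hA, B, hB, hBA, -, -, i, v, hd, hv, hz, h1, h2⟩ :=
      hQ.exists_contact_of_isReflexPoint hmid
    have hd' := hd
    obtain ⟨hi, hk, hik, -⟩ := hd'
    simp only [Pi.add_apply, Pi.smul_apply, smul_eq_mul] at hv hz h1 h2
    have f1 := hflat i hik
    have f2 := hflat 2 hk.symm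
    obtain ⟨x, y⟩ := e
    dsimp only at *
    have hx : x = linePt k v (A.hi 2) (x k) := eq_linePt hi hk hik (by linarith) rfl (by linarith)
    have hy : y = linePt k v (A.hi 2) (y k) := eq_linePt hi hk hik (by linarith) rfl (by linarith)
    rw [hx] at hn1
    rw [hy] at hn2
    rw [hx, hy, openSegment_linePt _ _ _ hlt] at hopen
    have g1 : x k = A.lo k := by
      rcases lt_trichotomy (x k) (A.lo k) with h | h | h
      · exact absurd (hopen _ ⟨A.lo k, ⟨h, by linarith⟩, rfl⟩)
          (hQ.not_isReflexPoint hA hB hBA hd (Or.inl rfl))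
      · exact h
      · exact absurd (hQ.isReflexPoint hA hB hBA hd ⟨h, by linarith⟩) hn1
    have g2 : y k = A.hi k := by
      rcases lt_trichotomy (y k) (A.hi k) with h | h | h
      · exact absurd (hQ.isReflexPoint hA hB hBA hd ⟨by linarith, h⟩) hn2
      · exact h
      · exact absurd (hopen _ ⟨A.hi k, ⟨by linarith, h⟩, rfl⟩)
          (hQ.not_isReflexPoint hA hB hBA hd (Or.inr rfl))
    refine ⟨A, hA, B, hB, hBA, i, k, v, hd, ?_⟩
    rw [lineEdge, ← g1, ← g2, ← hx, ← hy]
  · rintro ⟨A, hA, B, hB, hBA, i, j, v, hd, rfl⟩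
    have hj := hd.2.1
    refine ⟨j, ?_, ?_, ?_, hQ.not_isReflexPoint hA hB hBA hd (Or.inl rfl),
      hQ.not_isReflexPoint hA hB hBA hd (Or.inr rfl)⟩
    · simpa [lineEdge, linePt_dir hj] using A.lo_lt_hi j
    · intro n hn
      simp [lineEdge, linePt, hn]
    · rw [lineEdge, openSegment_linePt _ _ _ (A.lo_lt_hi j)]
      rintro _ ⟨t, ht, rfl⟩
      exact hQ.isReflexPoint hA hB hBA hd ht

/-- The pairs of bricks attached to each other, the lower one first. -/
def contacts (Q : Set Brick) : Set (Brick × Brick) := {c | c.1 ∈ Q ∧ c.2 ∈ Q ∧ c.2.SitsOn c.1}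

theorem contacts_finite (hQ : Q.Finite) : (contacts Q).Finite :=
  (hQ.prod hQ).subset fun _ h => ⟨h.1, h.2.1⟩

/-- An endpoint of the edge lies in all the bricks concerned, and at most two bricks share a point.
-/
theorem PrimitiveFamily.eq_of_isContactEdge (hQ : PrimitiveFamily Q) {A B A' B' : Brick}
    (hA : A ∈ Q) (hB : B ∈ Q) (hA' : A' ∈ Q) (hB' : B' ∈ Q) (hBA : B.SitsOn A)
    (hBA' : B'.SitsOn A') {e : Pt × Pt} (he : IsContactEdge A B e) (he' : IsContactEdge A' B' e) :
    A = A' ∧ B = B' := by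
  have key : ∀ {A B : Brick}, B.SitsOn A → IsContactEdge A B e → e.1 ∈ A.solid ∧ e.1 ∈ B.solid := by
    rintro A B hBA ⟨i, j, v, hd, rfl⟩
    exact hd.mem_solids hBA ⟨le_rfl, (A.lo_lt_hi j).le⟩
  obtain ⟨h1, h2⟩ := key hBA he
  obtain ⟨h1', h2'⟩ := key hBA' he'
  have hA2 := A.lo_lt_hi 2
  have hB2 := B.lo_lt_hi 2
  have hz := hBA.1
  have hz' := hBA'.1
  rcases hQ.eq_or_eq_of_mem hA hB hA' hBA h1 h2 h1' with rfl | rfl <;>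
  rcases hQ.eq_or_eq_of_mem hA hB hB' hBA h1 h2 h2' with rfl | rfl
  · exact absurd hz' hA2.ne'
  · exact ⟨rfl, rfl⟩
  · linarith
  · exact absurd hz' hB2.ne'

theorem PrimitiveFamily.ncard_reflexEdges (hQ : PrimitiveFamily Q) :
    (reflexEdges (⋃ B ∈ Q, B.solid)).Finite ∧
      (reflexEdges (⋃ B ∈ Q, B.solid)).ncard = (contacts Q).ncard := by
  have hex : ∀ c ∈ contacts Q, ∃ e, IsContactEdge c.1 c.2 e := by
    rintro ⟨A, B⟩ ⟨hA, hB, hBA⟩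
    obtain ⟨i, j, v, hd⟩ := (hQ.primitive A hA B hB hBA).exists_contactData
    exact ⟨_, i, j, v, hd, rfl⟩
  choose! f hf using hex
  have himage : reflexEdges (⋃ B ∈ Q, B.solid) = f '' contacts Q := by
    ext e
    rw [hQ.mem_reflexEdges_iff]
    constructor
    · rintro ⟨A, hA, B, hB, hBA, he⟩
      have hc : (A, B) ∈ contacts Q := ⟨hA, hB, hBA⟩
      exact ⟨(A, B), hc, (hf _ hc).unique he⟩
    · rintro ⟨⟨A, B⟩, hc, rfl⟩
      exact ⟨A, hc.1, B, hc.2.1, hc.2.2, hf _ hc⟩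
  rw [himage]
  refine ⟨(contacts_finite hQ.finite).image f, InjOn.ncard_image ?_⟩
  rintro ⟨A, B⟩ hc ⟨A', B'⟩ hc' he
  have h1 := hf _ hc
  rw [he] at h1
  obtain ⟨rfl, rfl⟩ := hQ.eq_of_isContactEdge hc.1 hc.2.1 hc'.1 hc'.2.1 hc.2.2 hc'.2.2 h1
    (hf _ hc')
  rfl

end

/-! ### The bricks of a castle form a binary tree. -/

/-- The bricks of a castle with base brick `B`, arranged as a binary tree, `k` being the number of
bricks with two bricks attached to their top faces. -/
inductive BrickTree : Brick → Set Brick → ℕ → Prop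
  | leaf (B : Brick) : BrickTree B {B} 0
  | node {B B₁ B₂ : Brick} {T₁ T₂ : Set Brick} {k₁ k₂ : ℕ} {i j : Fin 3}
      (hi : i ≠ 2) (hj : j ≠ 2) (hij : i ≠ j) (h₁ : B₁.SitsOn B) (h₂ : B₂.SitsOn B)
      (hl₁ : B₁.lo j = B.lo j) (hh₁ : B₁.hi j = B.hi j)
      (hl₂ : B₂.lo j = B.lo j) (hh₂ : B₂.hi j = B.hi j)
      (hl : B₁.lo i = B.lo i) (hh : B₂.hi i = B.hi i) (hgap : B₁.hi i < B₂.lo i)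
      (H₁ : BrickTree B₁ T₁ k₁) (H₂ : BrickTree B₂ T₂ k₂) :
      BrickTree B (insert B (T₁ ∪ T₂)) (k₁ + k₂ + 1)

section

variable {B : Brick} {T : Set Brick} {k : ℕ}

theorem BrickTree.root_mem (H : BrickTree B T k) : B ∈ T := by
  cases H with
  | leaf => exact rfl
  | node => exact mem_insert _ _

theorem BrickTree.bounds (H : BrickTree B T k) : ∀ A ∈ T,
    (∀ n, n ≠ 2 → B.lo n ≤ A.lo n ∧ A.hi n ≤ B.hi n) ∧ (A = B ∨ B.hi 2 ≤ A.lo 2) := by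
  induction H with
  | leaf B =>
    rintro A rfl
    exact ⟨fun _ _ => ⟨le_rfl, le_rfl⟩, Or.inl rfl⟩
  | @node B B₁ B₂ T₁ T₂ k₁ k₂ i j hi hj hij h₁ h₂ hl₁ hh₁ hl₂ hh₂ hl hh hgap H₁ H₂ ih₁ ih₂ =>
    have e₁ := B₁.lo_lt_hi i
    have e₂ := B₂.lo_lt_hi i
    rintro A (rfl | hA | hA)
    · exact ⟨fun _ _ => ⟨le_rfl, le_rfl⟩, Or.inl rfl⟩
    · obtain ⟨g, g'⟩ := ih₁ A hA
      refine ⟨fun n hn => ?_, Or.inr ?_⟩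
      · have := g n hn
        rcases eq_or_eq_of_ne_two hi hj hij hn with rfl | rfl <;> constructor <;> linarith
      · have := h₁.1
        have := B₁.lo_lt_hi 2
        rcases g' with rfl | g' <;> linarith
    · obtain ⟨g, g'⟩ := ih₂ A hA
      refine ⟨fun n hn => ?_, Or.inr ?_⟩
      · have := g n hn
        rcases eq_or_eq_of_ne_two hi hj hij hn with rfl | rfl <;> constructor <;> linarith
      · have := h₂.1
        have := B₂.lo_lt_hi 2
        rcases g' with rfl | g' <;> linarith

theorem BrickTree.ncard (H : BrickTree B T k) : T.Finite ∧ T.ncard = 2 * k + 1 := by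
  induction H with
  | leaf B => simp
  | @node B B₁ B₂ T₁ T₂ k₁ k₂ i j hi hj hij h₁ h₂ hl₁ hh₁ hl₂ hh₂ hl hh hgap H₁ H₂ ih₁ ih₂ =>
    have hfin := ih₁.1.union ih₂.1
    refine ⟨hfin.insert _, ?_⟩
    have hdisj : Disjoint T₁ T₂ := by
      refine disjoint_left.2 fun A hA hA' => ?_
      have g := ((H₁.bounds A hA).1 i hi).2
      have g' := ((H₂.bounds A hA').1 i hi).1
      linarith [A.lo_lt_hi i]
    have hB : B ∉ T₁ ∪ T₂ := by
      have := B.lo_lt_hi 2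
      rintro (hB | hB)
      · have := h₁.1
        have := B₁.lo_lt_hi 2
        rcases (H₁.bounds B hB).2 with rfl | g <;> linarith
      · have := h₂.1
        have := B₂.lo_lt_hi 2
        rcases (H₂.bounds B hB).2 with rfl | g <;> linarith
    rw [ncard_insert_of_notMem hB hfin, ncard_union_eq hdisj ih₁.1 ih₂.1, ih₁.2, ih₂.2]
    ring

theorem BrickTree.exists_parent (H : BrickTree B T k) :
    ∀ A ∈ T, A = B ∨ ∃ A' ∈ T, A.SitsOn A' := by
  induction H with
  | leaf B => exact fun A hA => Or.inl hA
  | node hi hj hij h₁ h₂ hl₁ hh₁ hl₂ hh₂ hl hh hgap H₁ H₂ ih₁ ih₂ =>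
    rintro A (rfl | hA | hA)
    · exact Or.inl rfl
    · rcases ih₁ A hA with rfl | ⟨A', hA', h⟩
      · exact Or.inr ⟨_, mem_insert _ _, h₁⟩
      · exact Or.inr ⟨A', Or.inr (Or.inl hA'), h⟩
    · rcases ih₂ A hA with rfl | ⟨A', hA', h⟩
      · exact Or.inr ⟨_, mem_insert _ _, h₂⟩
      · exact Or.inr ⟨A', Or.inr (Or.inr hA'), h⟩

end

section

variable {C : Set Pt} {Q : Set Brick}

theorem Brick.SitsOn.lo_lt {A B : Brick} (h : B.SitsOn A) : A.lo 2 < B.lo 2 := by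
  rw [← h.1]; exact A.lo_lt_hi 2

theorem Brick.NarrowerThan.subset {A B : Brick} (h : B.NarrowerThan A) :
    ∀ n, n ≠ 2 → A.lo n ≤ B.lo n ∧ B.hi n ≤ A.hi n := by
  obtain ⟨i, j, hi, hj, hij, h1, h2, h3⟩ := h
  intro n hn
  rcases eq_or_eq_of_ne_two hi hj hij hn with rfl | rfl
  · rcases h3 with ⟨h3, h4⟩ | ⟨h3, h4⟩ <;> constructor <;> linarith
  · exact ⟨h1.ge, h2.le⟩

theorem IsBrickPartition.eq_of_mem_of_lo_eq (hQ : IsBrickPartition C Q) {A B : Brick} (hA : A ∈ Q)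
    (hB : B ∈ Q) {p : Pt} (hpA : p ∈ A.solid) (hpB : p ∈ B.solid)
    (h : A.lo 2 = B.lo 2 ∨ A.hi 2 = B.hi 2) : A = B := by
  by_contra hne
  have h1 := A.lo_lt_hi 2
  have h2 := B.lo_lt_hi 2
  rcases hQ.touch A hA B hB hne with h' | h' | h'
  · exact disjoint_left.1 h' hpA hpB
  · have := h'.1
    rcases h with h | h <;> linarith
  · have := h'.1
    rcases h with h | h <;> linarith

theorem IsBrickPartition.exists_separated (hQ : IsBrickPartition C Q) {A B : Brick} (hA : A ∈ Q)
    (hB : B ∈ Q) (hne : A ≠ B) (h : A.lo 2 = B.lo 2) :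
    ∃ n, n ≠ 2 ∧ (A.hi n < B.lo n ∨ B.hi n < A.lo n) := by
  by_contra! hcon
  have key : ∀ n, A.lo n ≤ B.hi n ∧ B.lo n ≤ A.hi n := by
    intro n
    by_cases hn : n = 2
    · subst hn
      have h1 := A.lo_lt_hi 2
      have h2 := B.lo_lt_hi 2
      constructor <;> linarith
    · exact ⟨(hcon n hn).2, (hcon n hn).1⟩
  refine hne (hQ.eq_of_mem_of_lo_eq hA hB (p := fun n => max (A.lo n) (B.lo n)) ?_ ?_ (Or.inl h))
  · exact Brick.mem_solid_iff.2 fun n =>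
      ⟨le_max_left _ _, max_le (A.lo_lt_hi n).le (key n).2⟩
  · exact Brick.mem_solid_iff.2 fun n =>
      ⟨le_max_right _ _, max_le (key n).1 (B.lo_lt_hi n).le⟩

/-- If two bricks of a stack sit on the same brick, they are narrower than that brick. -/
theorem IsStack.narrowerThan (hQ : IsStack C Q) {A B B' : Brick} (hA : A ∈ Q) (hB : B ∈ Q)
    (hB' : B' ∈ Q) (hne : B ≠ B') (h : B.SitsOn A) (h' : B'.SitsOn A) : B.NarrowerThan A := by
  -- If `A` were the narrower one, `B` would cover its whole footprint and leave no room for `B'`.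
  refine (hQ.primitive A hA B hB h).2.resolve_right fun hn => ?_
  obtain ⟨n, hn2, hsep⟩ := hQ.exists_separated hB hB' hne (h.1.symm.trans h'.1)
  have h1 := hn.subset n hn2
  have h2 := h'.2 n hn2
  have h3 := (le_max_left _ _).trans_lt (h2.trans_le (min_le_right _ _))
  have h4 := (le_max_right _ _).trans_lt (h2.trans_le (min_le_left _ _))
  rcases hsep with hsep | hsep <;> linarith

/-- Two disjoint bricks on the same face can only be separated in the direction in which each was
pushed inwards, so they are flush with opposite sides of `A` and leave a gap. -/
theorem IsCastle.children (hQ : IsCastle C Q) {A : Brick} (hA : A ∈ Q) :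
    (∀ B ∈ Q, ¬ B.SitsOn A) ∨ ∃ B₁ ∈ Q, ∃ B₂ ∈ Q, B₁.SitsOn A ∧ B₂.SitsOn A ∧
      B₁.NarrowerThan A ∧ B₂.NarrowerThan A ∧ (∀ B ∈ Q, B.SitsOn A → B = B₁ ∨ B = B₂) ∧
      ∃ i j, i ≠ 2 ∧ j ≠ 2 ∧ i ≠ j ∧ B₁.lo j = A.lo j ∧ B₁.hi j = A.hi j ∧
        B₂.lo j = A.lo j ∧ B₂.hi j = A.hi j ∧ B₁.lo i = A.lo i ∧ B₂.hi i = A.hi i ∧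
        B₁.hi i < B₂.lo i := by
  have hfin : {B ∈ Q | B.SitsOn A}.Finite := hQ.finite.subset fun _ h => h.1
  rcases hQ.zero_or_two A hA with h0 | h2
  · left
    intro B hB h
    rw [ncard_eq_zero hfin] at h0
    exact (h0 ▸ (⟨hB, h⟩ : B ∈ {B ∈ Q | B.SitsOn A}) : B ∈ (∅ : Set Brick))
  · right
    obtain ⟨B, B', hne, hset⟩ := ncard_eq_two.1 h2
    have hall : ∀ X ∈ Q, X.SitsOn A → X = B ∨ X = B' := by
      intro X hX h
      have : X ∈ ({B, B'} : Set Brick) := hset ▸ ⟨hX, h⟩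
      simpa using this
    obtain ⟨hB, hBA⟩ : B ∈ {B ∈ Q | B.SitsOn A} := hset ▸ mem_insert _ _
    obtain ⟨hB', hBA'⟩ : B' ∈ {B ∈ Q | B.SitsOn A} := hset ▸ mem_insert_of_mem _ rfl
    have hN := hQ.narrowerThan hA hB hB' hne hBA hBA'
    have hN' := hQ.narrowerThan hA hB' hB hne.symm hBA' hBA
    obtain ⟨n, hn, hsep⟩ := hQ.exists_separated hB hB' hne (hBA.1.symm.trans hBA'.1)
    have hNN := hN
    have hNN' := hN'
    obtain ⟨i, j, hi, hj, hij, h1, h2, h3⟩ := hNN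
    obtain ⟨i', j', hi', hj', hij', h1', h2', h3'⟩ := hNN'
    have hsub := hN.subset n hn
    have hsub' := hN'.subset n hn
    have e := B.lo_lt_hi n
    have e' := B'.lo_lt_hi n
    have hni : n = i := by
      refine (eq_or_eq_of_ne_two hi hj hij hn).resolve_right ?_
      rintro rfl
      rcases hsep with hsep | hsep <;> linarith
    have hni' : n = i' := by
      refine (eq_or_eq_of_ne_two hi' hj' hij' hn).resolve_right ?_
      rintro rfl
      rcases hsep with hsep | hsep <;> linarith
    subst hni hni'
    obtain rfl : j' = j := (eq_or_eq_of_ne_two hi hj hij hj').resolve_left hij'.symm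
    rcases hsep with hsep | hsep
    · refine ⟨B, hB, B', hB', hBA, hBA', hN, hN', hall, n, j', hi, hj, hij, h1, h2, h1', h2',
        ?_, ?_, hsep⟩
      · rcases h3 with h3 | h3 <;> linarith [h3.1, h3.2]
      · rcases h3' with h3' | h3' <;> linarith [h3'.1, h3'.2]
    · refine ⟨B', hB', B, hB, hBA', hBA, hN', hN, fun X hX h => (hall X hX h).symm, n, j', hi, hj,
        hij, h1', h2', h1, h2, ?_, ?_, hsep⟩
      · rcases h3' with h3' | h3' <;> linarith [h3'.1, h3'.2]
      · rcases h3 with h3 | h3 <;> linarith [h3.1, h3.2]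

/-- In a castle an attached brick has a sibling, hence is narrower than its support. Its corner
`B.lo` thus lies on every support, and two bricks with a common point and equal top heights
coincide. -/
theorem IsCastle.parent_unique (hQ : IsCastle C Q) {A A' B : Brick} (hA : A ∈ Q) (hA' : A' ∈ Q)
    (hB : B ∈ Q) (h : B.SitsOn A) (h' : B.SitsOn A') : A = A' := by
  have key : ∀ A ∈ Q, B.SitsOn A → B.lo ∈ A.solid := by
    intro A hA h
    have hsub : ∀ n, n ≠ 2 → A.lo n ≤ B.lo n ∧ B.hi n ≤ A.hi n := by
      rcases hQ.children hA with h0 | ⟨B₁, -, B₂, -, -, -, hN₁, hN₂, hall, -⟩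
      · exact absurd h (h0 B hB)
      · rcases hall B hB h with rfl | rfl
        · exact hN₁.subset
        · exact hN₂.subset
    refine Brick.mem_solid_iff.2 fun n => ?_
    by_cases hn : n = 2
    · subst hn
      rw [← h.1]
      exact ⟨(A.lo_lt_hi 2).le, le_rfl⟩
    · exact ⟨(hsub n hn).1, (B.lo_lt_hi n).le.trans (hsub n hn).2⟩
  exact hQ.eq_of_mem_of_lo_eq hA hA' (key A hA h) (key A' hA' h') (Or.inr (h.1.trans h'.1.symm))

/-- Induction on the number of bricks starting strictly higher than `B`. That `T` contains
everything attached above its members is needed for the connectedness argument. -/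
theorem IsCastle.exists_brickTree (hQ : IsCastle C Q) (m : ℕ) : ∀ B ∈ Q,
    {A ∈ Q | B.lo 2 < A.lo 2}.ncard = m →
    ∃ T k, BrickTree B T k ∧ T ⊆ Q ∧ ∀ X ∈ T, ∀ Y ∈ Q, Y.SitsOn X → Y ∈ T := by
  induction m using Nat.strong_induction_on with
  | _ m IH =>
  intro B hB hm
  have hlt : ∀ B' ∈ Q, B'.SitsOn B → {A ∈ Q | B'.lo 2 < A.lo 2}.ncard < m := by
    intro B' hB' h
    rw [← hm]
    refine ncard_lt_ncard ⟨fun A hA => ⟨hA.1, h.lo_lt.trans hA.2⟩, fun hsub => ?_⟩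
      (hQ.finite.subset fun _ h => h.1)
    exact lt_irrefl _ (hsub (⟨hB', h.lo_lt⟩ : B' ∈ {A ∈ Q | B.lo 2 < A.lo 2})).2
  rcases hQ.children hB with h0 | ⟨B₁, hB₁, B₂, hB₂, h₁, h₂, -, -, hall, i, j, hi, hj, hij,
    hl₁, hh₁, hl₂, hh₂, hl, hh, hgap⟩
  · refine ⟨{B}, 0, .leaf B, singleton_subset_iff.2 hB, ?_⟩
    rintro X rfl Y hY h
    exact absurd h (h0 Y hY)
  · obtain ⟨T₁, k₁, H₁, hT₁, hcl₁⟩ := IH _ (hlt B₁ hB₁ h₁) B₁ hB₁ rfl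
    obtain ⟨T₂, k₂, H₂, hT₂, hcl₂⟩ := IH _ (hlt B₂ hB₂ h₂) B₂ hB₂ rfl
    refine ⟨_, _, .node hi hj hij h₁ h₂ hl₁ hh₁ hl₂ hh₂ hl hh hgap H₁ H₂,
      insert_subset hB (union_subset hT₁ hT₂), ?_⟩
    rintro X (rfl | hX | hX) Y hY h
    · rcases hall Y hY h with rfl | rfl
      · exact Or.inr (Or.inl H₁.root_mem)
      · exact Or.inr (Or.inr H₂.root_mem)
    · exact Or.inr (Or.inl (hcl₁ X hX Y hY h))
    · exact Or.inr (Or.inr (hcl₂ X hX Y hY h))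

/-- No brick outside the tree touches it: the tree is closed upwards by construction and downwards
by uniqueness of parents, and nothing lies under the base. The tree and the rest would be disjoint
closed sets covering the connected solid. -/
theorem IsCastle.brickTree (hQ : IsCastle C Q) {B : Brick} (hB : IsBaseBrick Q B) :
    ∃ k, BrickTree B Q k := by
  obtain ⟨T, k, H, hTQ, hcl⟩ := hQ.exists_brickTree _ B hB.1 rfl
  suffices T = Q from ⟨k, this ▸ H⟩
  refine hTQ.antisymm fun Y hY => ?_
  by_contra hYT
  have hclosed : ∀ R : Set Brick, R ⊆ Q → IsClosed (⋃ X ∈ R, X.solid) := fun R hR =>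
    (hQ.finite.subset hR).isClosed_biUnion fun _ _ => isClosed_Icc
  have hmem : ∀ X ∈ Q, X.lo ∈ C ∩ X.solid := by
    intro X hX
    have h : X.lo ∈ X.solid := ⟨le_rfl, fun n => (X.lo_lt_hi n).le⟩
    exact ⟨hQ.union_eq ▸ mem_biUnion hX h, h⟩
  obtain ⟨p, -, hpT, hpQ⟩ := isPreconnected_closed_iff.1 hQ.connected.isPreconnected
    (⋃ X ∈ T, X.solid) (⋃ X ∈ Q \ T, X.solid) (hclosed T hTQ) (hclosed _ sdiff_subset)
    (by rw [← biUnion_union, union_sdiff_cancel hTQ, hQ.union_eq])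
    ⟨B.lo, (hmem B hB.1).1, mem_biUnion H.root_mem (hmem B hB.1).2⟩
    ⟨Y.lo, (hmem Y hY).1, mem_biUnion (⟨hY, hYT⟩ : Y ∈ Q \ T) (hmem Y hY).2⟩
  simp only [mem_iUnion, exists_prop] at hpT hpQ
  obtain ⟨X, hXT, hpX⟩ := hpT
  obtain ⟨Z, ⟨hZQ, hZT⟩, hpZ⟩ := hpQ
  rcases hQ.touch X (hTQ hXT) Z hZQ (by rintro rfl; exact hZT hXT) with h | h | h
  · exact disjoint_left.1 h hpX hpZ
  · exact hZT (hcl X hXT Z hZQ h)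
  · rcases H.exists_parent X hXT with rfl | ⟨X', hX', h'⟩
    · exact (hB.2 Z hZQ).not_gt h.lo_lt
    · exact hZT (hQ.parent_unique hZQ (hTQ hX') (hTQ hXT) h h' ▸ hX')

/-- Each brick except the base is the upper brick of exactly one contact. -/
theorem IsCastle.ncard_contacts (hQ : IsCastle C Q) {B : Brick} {k : ℕ} (H : BrickTree B Q k) :
    (contacts Q).ncard = 2 * k := by
  have himage : Prod.snd '' contacts Q = Q \ {B} := by
    ext X
    constructor
    · rintro ⟨⟨A, X⟩, ⟨hA, hX, h⟩, rfl⟩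
      refine ⟨hX, fun hXB => ?_⟩
      obtain rfl : X = B := hXB
      have h1 := h.lo_lt
      have h2 := X.lo_lt_hi 2
      rcases (H.bounds A hA).2 with rfl | h3
      · exact lt_irrefl _ h1
      · dsimp only at h1; linarith
    · rintro ⟨hX, hXB⟩
      obtain ⟨A, hA, h⟩ := (H.exists_parent X hX).resolve_left hXB
      exact ⟨(A, X), ⟨hA, hX, h⟩, rfl⟩
  have hinj : InjOn Prod.snd (contacts Q) := by
    rintro ⟨A, X⟩ ⟨hA, hX, h⟩ ⟨A', X'⟩ ⟨hA', hX', h'⟩ heq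
    obtain rfl : X = X' := heq
    exact Prod.ext (hQ.parent_unique hA hA' hX h h') rfl
  rw [← hinj.ncard_image, himage, ncard_sdiff_singleton_of_mem H.root_mem, H.ncard.2]
  rfl

end

/-! ### From trees of bricks to `Castle`, upright and turned. -/

section

theorem Brick.solid_eq_box (B : Brick) : B.solid = box 1 B.lo B.hi (B.lo 2) (B.hi 2) := by
  ext p
  rw [Brick.mem_solid_iff]
  simp only [box, one_mul, mem_ofPred_eq]
  refine ⟨fun h => ⟨fun n _ => h n, h 2⟩, fun h n => ?_⟩
  by_cases hn : n = 2
  · rw [hn]; exact h.2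
  · exact h.1 n hn

theorem Brick.solid_turn_eq_box (B : Brick) :
    B.turn.solid = box (-1) B.turn.lo B.turn.hi (B.lo 2) (B.hi 2) := by
  have e1 : B.turn.lo 2 = -B.hi 2 := rfl
  have e2 : B.turn.hi 2 = -B.lo 2 := rfl
  ext p
  rw [B.turn.solid_eq_box]
  simp only [box, e1, e2, mem_ofPred_eq]
  refine and_congr_right fun _ => ?_
  constructor <;> rintro ⟨h1, h2⟩ <;> constructor <;> linarith

variable {D : Set Pt} {E : Set (Pt × Pt)} {B : Brick} {T : Set Brick} {k : ℕ}

theorem BrickTree.castle (H : BrickTree B T k) (hD : ∀ X ∈ T, X.solid ⊆ D)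
    (hE : ∀ X ∈ T, ∀ Y ∈ T, Y.SitsOn X → ∀ e, IsContactEdge X Y e → e ∈ E) :
    Castle D E 1 B.lo B.hi (B.lo 2) (⋃ X ∈ T, X.solid) k := by
  induction H with
  | leaf B =>
    rw [biUnion_singleton, B.solid_eq_box]
    exact .leaf (fun n _ => B.lo_lt_hi n) (B.lo_lt_hi 2) (B.solid_eq_box ▸ hD B rfl)
  | @node B B₁ B₂ T₁ T₂ k₁ k₂ i j hi hj hij h₁ h₂ hl₁ hh₁ hl₂ hh₂ hl hh hgap H₁ H₂ ih₁ ih₂ =>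
    have hB : B ∈ insert B (T₁ ∪ T₂) := mem_insert _ _
    have hT₁ : ∀ X ∈ T₁, X ∈ insert B (T₁ ∪ T₂) := fun X hX => Or.inr (Or.inl hX)
    have hT₂ : ∀ X ∈ T₂, X ∈ insert B (T₁ ∪ T₂) := fun X hX => Or.inr (Or.inr hX)
    have e₁ := B₁.lo_lt_hi i
    have e₂ := B₂.lo_lt_hi i
    have c₁ := ih₁ (fun X hX => hD X (hT₁ X hX))
      (fun X hX Y hY => hE X (hT₁ X hX) Y (hT₁ Y hY))
    have c₂ := ih₂ (fun X hX => hD X (hT₂ X hX))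
      (fun X hX Y hY => hE X (hT₂ X hX) Y (hT₂ Y hY))
    rw [← h₁.1] at c₁
    rw [← h₂.1] at c₂
    rw [biUnion_insert, biUnion_union, ← union_assoc, B.solid_eq_box]
    refine .node (fun n _ => B.lo_lt_hi n) (B.lo_lt_hi 2) (B.solid_eq_box ▸ hD B hB) hi hj hij
      hl₁ hh₁ hl₂ hh₂ hl hh hgap ?_ ?_ c₁ c₂
    · refine hE B hB B₁ (hT₁ _ H₁.root_mem) h₁ _ ⟨i, j, _, ⟨hi, hj, hij, hl₁.symm, hh₁.symm,
        Or.inl ⟨hl.symm, by linarith, ?_⟩⟩, by rw [one_mul]⟩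
      rw [min_eq_right]; linarith
    · refine hE B hB B₂ (hT₂ _ H₂.root_mem) h₂ _ ⟨i, j, _, ⟨hi, hj, hij, hl₂.symm, hh₂.symm,
        Or.inr ⟨hh.symm, by linarith, ?_⟩⟩, by rw [one_mul]⟩
      rw [max_eq_right]; linarith

theorem BrickTree.castle_turn (H : BrickTree B T k) (hD : ∀ X ∈ T, X.turn.solid ⊆ D)
    (hE : ∀ X ∈ T, ∀ Y ∈ T, Y.SitsOn X → ∀ e, IsContactEdge Y.turn X.turn e → e ∈ E) :
    Castle D E (-1) B.turn.lo B.turn.hi (B.lo 2) (⋃ X ∈ T, X.turn.solid) k := by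
  induction H with
  | leaf B =>
    rw [biUnion_singleton, B.solid_turn_eq_box]
    exact .leaf (fun n _ => B.turn.lo_lt_hi n) (B.lo_lt_hi 2) (B.solid_turn_eq_box ▸ hD B rfl)
  | @node B B₁ B₂ T₁ T₂ k₁ k₂ i j hi hj hij h₁ h₂ hl₁ hh₁ hl₂ hh₂ hl hh hgap H₁ H₂ ih₁ ih₂ =>
    have hB : B ∈ insert B (T₁ ∪ T₂) := mem_insert _ _
    have hT₁ : ∀ X ∈ T₁, X ∈ insert B (T₁ ∪ T₂) := fun X hX => Or.inr (Or.inl hX)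
    have hT₂ : ∀ X ∈ T₂, X ∈ insert B (T₁ ∪ T₂) := fun X hX => Or.inr (Or.inr hX)
    have c₁ := ih₁ (fun X hX => hD X (hT₁ X hX))
      (fun X hX Y hY => hE X (hT₁ X hX) Y (hT₁ Y hY))
    have c₂ := ih₂ (fun X hX => hD X (hT₂ X hX))
      (fun X hX Y hY => hE X (hT₂ X hX) Y (hT₂ Y hY))
    rw [← h₁.1] at c₁
    rw [← h₂.1] at c₂
    have hE₁ := hE B hB B₁ (hT₁ _ H₁.root_mem) h₁
    have hE₂ := hE B hB B₂ (hT₂ _ H₂.root_mem) h₂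
    have e₁ := B₁.lo_lt_hi i
    have e₂ := B₂.lo_lt_hi i
    have hz₁ : -B₁.lo 2 = -1 * B.hi 2 := by rw [h₁.1]; ring
    have hz₂ : -B₂.lo 2 = -1 * B.hi 2 := by rw [h₂.1]; ring
    have hlt := fun n (_ : n ≠ (2 : Fin 3)) => B.turn.lo_lt_hi n
    have hbox := B.solid_turn_eq_box ▸ hD B hB
    rw [biUnion_insert, biUnion_union, ← union_assoc, B.solid_turn_eq_box]
    -- `turn` reverses coordinate `1` and keeps coordinate `0`, so the two children exchange places
    -- exactly when they are separated along `1`.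
    obtain ⟨rfl, rfl⟩ | ⟨rfl, rfl⟩ : i = 0 ∧ j = 1 ∨ i = 1 ∧ j = 0 := by
      revert hi hj hij; clear * -; revert i j; decide
    · refine .node (i := 0) (j := 1) (l₁ := B₁.turn.lo) (h₁ := B₁.turn.hi) (l₂ := B₂.turn.lo)
        (h₂ := B₂.turn.hi) hlt (B.lo_lt_hi 2) hbox hi hj hij (congrArg Neg.neg hh₁)
        (congrArg Neg.neg hl₁) (congrArg Neg.neg hh₂) (congrArg Neg.neg hl₂) hl hh hgap ?_ ?_ c₁ c₂
      · refine hE₁ _ ⟨0, 1, B₁.turn.hi 0, ⟨hi, hj, hij, congrArg Neg.neg hh₁,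
          congrArg Neg.neg hl₁, Or.inl ⟨hl, ?_, ?_⟩⟩, ?_⟩
        · change B₁.hi 0 ≠ B.hi 0; linarith
        · change B₁.hi 0 = min (B₁.hi 0) (B.hi 0); rw [min_eq_left]; linarith
        · change _ = lineEdge 1 (B₁.hi 0) (-B₁.lo 2) (-B₁.hi 1) (-B₁.lo 1)
          rw [hz₁, hh₁, hl₁]; rfl
      · refine hE₂ _ ⟨0, 1, B₂.turn.lo 0, ⟨hi, hj, hij, congrArg Neg.neg hh₂,
          congrArg Neg.neg hl₂, Or.inr ⟨hh, ?_, ?_⟩⟩, ?_⟩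
        · change B₂.lo 0 ≠ B.lo 0; linarith
        · change B₂.lo 0 = max (B₂.lo 0) (B.lo 0); rw [max_eq_left]; linarith
        · change _ = lineEdge 1 (B₂.lo 0) (-B₂.lo 2) (-B₂.hi 1) (-B₂.lo 1)
          rw [hz₂, hh₂, hl₂]; rfl
    · rw [union_right_comm, add_comm k₁ k₂]
      refine .node (i := 1) (j := 0) (l₁ := B₂.turn.lo) (h₁ := B₂.turn.hi) (l₂ := B₁.turn.lo)
        (h₂ := B₁.turn.hi) hlt (B.lo_lt_hi 2) hbox hi hj hij hl₂ hh₂ hl₁ hh₁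
        (congrArg Neg.neg hh) (congrArg Neg.neg hl) (neg_lt_neg hgap) ?_ ?_ c₂ c₁
      · refine hE₂ _ ⟨1, 0, B₂.turn.hi 1, ⟨hi, hj, hij, hl₂, hh₂,
          Or.inl ⟨congrArg Neg.neg hh, ?_, ?_⟩⟩, ?_⟩
        · change -B₂.lo 1 ≠ -B.lo 1; intro h; linarith
        · change -B₂.lo 1 = min (-B₂.lo 1) (-B.lo 1); rw [min_eq_left]; linarith
        · change _ = lineEdge 0 (-B₂.lo 1) (-B₂.lo 2) (B₂.lo 0) (B₂.hi 0)
          rw [hz₂, hh₂, hl₂]; rfl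
      · refine hE₁ _ ⟨1, 0, B₁.turn.lo 1, ⟨hi, hj, hij, hl₁, hh₁,
          Or.inr ⟨congrArg Neg.neg hl, ?_, ?_⟩⟩, ?_⟩
        · change -B₁.hi 1 ≠ -B.hi 1; intro h; linarith
        · change -B₁.hi 1 = max (-B₁.hi 1) (-B.hi 1); rw [max_eq_left]; linarith
        · change _ = lineEdge 0 (-B₁.hi 1) (-B₁.lo 2) (B₁.lo 0) (B₁.hi 0)
          rw [hz₁, hh₁, hl₁]; rfl

end

/-! ### Turning upside down, gluing, and the conclusion. -/

theorem Brick.turn_turn (B : Brick) : B.turn.turn = B := by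
  obtain ⟨lo, hi, h⟩ := B
  have h1 : ![lo 0, - -lo 1, - -lo 2] = lo := by ext n; fin_cases n <;> simp
  have h2 : ![hi 0, - -hi 1, - -hi 2] = hi := by ext n; fin_cases n <;> simp
  change (⟨![lo 0, - -lo 1, - -lo 2], ![hi 0, - -hi 1, - -hi 2], _⟩ : Brick) = _
  congr 1

theorem Brick.turn_injective : Function.Injective Brick.turn :=
  Function.LeftInverse.injective Brick.turn_turn

theorem Brick.SitsOn.turn {A B : Brick} (h : B.SitsOn A) : A.turn.SitsOn B.turn := by
  obtain ⟨hz, h⟩ := h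
  refine ⟨congrArg Neg.neg hz.symm, fun i hi => ?_⟩
  obtain rfl | rfl : i = 0 ∨ i = 1 := by revert i; decide
  · have := h 0 hi
    rw [max_comm, min_comm] at this
    exact this
  · have := h 1 hi
    change max (-B.hi 1) (-A.hi 1) < min (-B.lo 1) (-A.lo 1)
    simp only [max_lt_iff, lt_min_iff, neg_lt_neg_iff] at this ⊢
    exact ⟨⟨this.2.2, this.1.2⟩, this.2.1, this.1.1⟩

theorem Brick.sitsOn_turn_iff {A B : Brick} : A.turn.SitsOn B.turn ↔ B.SitsOn A :=
  ⟨fun h => by simpa only [Brick.turn_turn] using h.turn, fun h => h.turn⟩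

theorem Brick.NarrowerThan.turn {A B : Brick} (h : B.NarrowerThan A) :
    B.turn.NarrowerThan A.turn := by
  obtain ⟨i, j, hi, hj, hij, h1, h2, h3⟩ := h
  refine ⟨i, j, hi, hj, hij, ?_⟩
  obtain ⟨rfl, rfl⟩ | ⟨rfl, rfl⟩ : i = 0 ∧ j = 1 ∨ i = 1 ∧ j = 0 := by
    clear * - hi hj hij; revert i j; decide
  · exact ⟨congrArg Neg.neg h2, congrArg Neg.neg h1, h3⟩
  · exact ⟨h1, h2, h3.symm.imp (fun h => ⟨congrArg Neg.neg h.2, neg_lt_neg h.1⟩)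
      (fun h => ⟨neg_lt_neg h.2, congrArg Neg.neg h.1⟩)⟩

theorem PrimitiveContact.turn {A B : Brick} (h : PrimitiveContact A B) :
    PrimitiveContact B.turn A.turn :=
  ⟨h.1.turn, h.2.symm.imp Brick.NarrowerThan.turn Brick.NarrowerThan.turn⟩

theorem Brick.disjoint_turn {A B : Brick} (h : Disjoint A.solid B.solid) :
    Disjoint A.turn.solid B.turn.solid := by
  rw [A.solid_turn, B.solid_turn]
  refine (disjoint_image_iff ?_).2 h
  intro p q hpq
  have h0 := congrFun hpq 0
  have h1 := congrFun hpq 1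
  have h2 := congrFun hpq 2
  simp only [OrthoPoly.turn, Matrix.cons_val, neg_inj] at h0 h1 h2
  ext n
  fin_cases n <;> assumption

theorem IsStack.primitiveFamily {C : Set Pt} {Q : Set Brick} (hQ : IsStack C Q) :
    PrimitiveFamily Q := ⟨hQ.finite, hQ.touch, hQ.primitive⟩

theorem PrimitiveFamily.turn {Q : Set Brick} (hQ : PrimitiveFamily Q) :
    PrimitiveFamily (Brick.turn '' Q) := by
  refine ⟨hQ.finite.image _, ?_, ?_⟩
  · rintro _ ⟨A, hA, rfl⟩ _ ⟨B, hB, rfl⟩ hne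
    rcases hQ.touch A hA B hB (fun h => hne (congrArg _ h)) with h | h | h
    · exact Or.inl (Brick.disjoint_turn h)
    · exact Or.inr (Or.inr h.turn)
    · exact Or.inr (Or.inl h.turn)
  · rintro _ ⟨A, hA, rfl⟩ _ ⟨B, hB, rfl⟩ h
    exact (hQ.primitive B hB A hA (Brick.sitsOn_turn_iff.1 h)).turn

theorem contacts_turn (Q : Set Brick) : contacts (Brick.turn '' Q) =
    (fun c : Brick × Brick => (c.2.turn, c.1.turn)) '' contacts Q := by
  ext ⟨A, B⟩
  constructor
  · rintro ⟨⟨A, hA, rfl⟩, ⟨B, hB, rfl⟩, h⟩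
    exact ⟨(B, A), ⟨hB, hA, Brick.sitsOn_turn_iff.1 h⟩, rfl⟩
  · rintro ⟨⟨X, Y⟩, ⟨hX, hY, h⟩, heq⟩
    obtain ⟨rfl, rfl⟩ := Prod.ext_iff.1 heq
    exact ⟨⟨Y, hY, rfl⟩, ⟨X, hX, rfl⟩, h.turn⟩

theorem ncard_contacts_turn (Q : Set Brick) :
    (contacts (Brick.turn '' Q)).ncard = (contacts Q).ncard := by
  rw [contacts_turn]
  refine InjOn.ncard_image ?_
  rintro ⟨A, B⟩ - ⟨A', B'⟩ - h
  obtain ⟨h1, h2⟩ := Prod.ext_iff.1 h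
  exact Prod.ext (Brick.turn_injective h2) (Brick.turn_injective h1)

/-- Two families of bricks, one lying above the other, in which only the bricks `A` and `B` come in
contact with each other. -/
theorem PrimitiveFamily.union {Q R : Set Brick} (hQ : PrimitiveFamily Q) (hR : PrimitiveFamily R)
    {A B : Brick} (hA : A ∈ R) (hB : B ∈ Q) (hAB : PrimitiveContact A B)
    (hQB : ∀ X ∈ Q, X = B ∨ B.lo 2 < X.lo 2) (hRA : ∀ X ∈ R, X = A ∨ X.hi 2 < A.hi 2) :
    PrimitiveFamily (Q ∪ R) ∧
      (contacts (Q ∪ R)).ncard = (contacts Q).ncard + (contacts R).ncard + 1 := by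
  have hz := hAB.1.1
  -- Only `B` reaches down to the contact plane and only `A` reaches up to it; every other pair is
  -- separated by height.
  have hcross : ∀ X ∈ Q, ∀ Y ∈ R, (X = B ∧ Y = A) ∨ Y.hi 2 < X.lo 2 := by
    intro X hX Y hY
    rcases hQB X hX with rfl | h
    · rcases hRA Y hY with rfl | h'
      · exact Or.inl ⟨rfl, rfl⟩
      · right; linarith
    · rcases hRA Y hY with rfl | h'
      · right; linarith
      · right; linarith
  have hdisj : ∀ X Y : Brick, Y.hi 2 < X.lo 2 → Disjoint X.solid Y.solid := by
    intro X Y h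
    refine disjoint_left.2 fun p hp hp' => ?_
    have := hp.1 2
    have := hp'.2 2
    linarith
  have hdown : ∀ X ∈ Q, ∀ Y ∈ R, ¬ Y.SitsOn X := by
    intro X hX Y hY h
    have h1 := h.1
    have h2 := X.lo_lt_hi 2
    have h3 := Y.lo_lt_hi 2
    rcases hcross X hX Y hY with ⟨rfl, rfl⟩ | h <;> linarith
  have hup : ∀ X ∈ Q, ∀ Y ∈ R, X.SitsOn Y → X = B ∧ Y = A := by
    intro X hX Y hY h
    refine (hcross X hX Y hY).resolve_right fun h' => ?_
    linarith [h.1]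
  have hQR : Disjoint Q R := by
    refine disjoint_left.2 fun X hX hX' => ?_
    have h2 := X.lo_lt_hi 2
    rcases hcross X hX X hX' with ⟨rfl, h⟩ | h
    · subst h; linarith
    · linarith
  refine ⟨⟨hQ.finite.union hR.finite, ?_, ?_⟩, ?_⟩
  · rintro X (hX | hX) Y (hY | hY) hne
    · exact hQ.touch X hX Y hY hne
    · rcases hcross X hX Y hY with ⟨rfl, rfl⟩ | h
      · exact Or.inr (Or.inr hAB.1)
      · exact Or.inl (hdisj X Y h)
    · rcases hcross Y hY X hX with ⟨rfl, rfl⟩ | h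
      · exact Or.inr (Or.inl hAB.1)
      · exact Or.inl (hdisj Y X h).symm
    · exact hR.touch X hX Y hY hne
  · rintro X (hX | hX) Y (hY | hY) h
    · exact hQ.primitive X hX Y hY h
    · exact absurd h (hdown X hX Y hY)
    · obtain ⟨rfl, rfl⟩ := hup Y hY X hX h
      exact hAB
    · exact hR.primitive X hX Y hY h
  · have hset : contacts (Q ∪ R) = insert (A, B) (contacts Q ∪ contacts R) := by
      ext ⟨X, Y⟩
      constructor
      · rintro ⟨hX | hX, hY | hY, h⟩
        · exact Or.inr (Or.inl ⟨hX, hY, h⟩)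
        · exact absurd h (hdown X hX Y hY)
        · obtain ⟨rfl, rfl⟩ := hup Y hY X hX h
          exact Or.inl rfl
        · exact Or.inr (Or.inr ⟨hX, hY, h⟩)
      · rintro (h | ⟨hX, hY, h⟩ | ⟨hX, hY, h⟩)
        · obtain ⟨rfl, rfl⟩ := Prod.ext_iff.1 h
          exact ⟨Or.inr hA, Or.inl hB, hAB.1⟩
        · exact ⟨Or.inl hX, Or.inl hY, h⟩
        · exact ⟨Or.inr hX, Or.inr hY, h⟩
    have f1 := contacts_finite hQ.finite
    have f2 := contacts_finite hR.finite
    rw [hset, ncard_insert_of_notMem ?_ (f1.union f2), ncard_union_eq ?_ f1 f2]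
    · exact disjoint_left.2 fun c h h' => disjoint_left.1 hQR h.1 h'.1
    · rintro (h | h)
      · exact disjoint_left.1 hQR h.1 hA
      · exact disjoint_left.1 hQR hB h.2.1

theorem Brick.NarrowerThan.exists_narrower {A B : Brick} (h : B.NarrowerThan A) :
    ∃ i j v, B.lo j = A.lo j ∧ B.hi j = A.hi j ∧ Narrower i B.lo B.hi A.lo A.hi v ∧
      ContactData A B i j v := by
  obtain ⟨i, j, hi, hj, hij, h1, h2, ⟨h3, h4⟩ | ⟨h3, h4⟩⟩ := h
  · exact ⟨i, j, B.hi i, h1, h2, Or.inl ⟨h3, h4.le, rfl⟩, hi, hj, hij, h1.symm, h2.symm,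
      Or.inl ⟨h3.symm, h4.ne', (min_eq_right h4.le).symm⟩⟩
  · exact ⟨i, j, B.lo i, h1, h2, Or.inr ⟨h3.le, h4, rfl⟩, hi, hj, hij, h1.symm, h2.symm,
      Or.inr ⟨h4.symm, h3.ne, (max_eq_right h3.le).symm⟩⟩

theorem ContactData.symm {A B : Brick} {i j : Fin 3} {v : ℝ} (h : ContactData A B i j v) :
    ContactData B A i j v := by
  obtain ⟨hi, hj, hij, h1, h2, h3⟩ := h
  refine ⟨hi, hj, hij, h1.symm, h2.symm, ?_⟩
  rw [min_comm, max_comm]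
  exact h3.imp (fun h => ⟨h.1.symm, h.2.1.symm, h.2.2⟩) (fun h => ⟨h.1.symm, h.2.1.symm, h.2.2⟩)

theorem GuardedByOpen.closed {P : Set Pt} {G : Set (Pt × Pt)} (h : GuardedByOpen P G) :
    GuardedByClosed P G := fun y hy =>
  let ⟨e, he, x, hx, hxy⟩ := h y hy
  ⟨e, he, x, openSegment_subset_segment _ _ _ hx, hxy⟩

theorem Lit.guardedByOpen {P : Set Pt} {G : Set (Pt × Pt)} (h : Lit P (edgePts G) P) :
    GuardedByOpen P G := fun y hy =>
  let ⟨x, ⟨e, he, hx⟩, hxy⟩ := h y hy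
  ⟨e, he, x, hx, hxy⟩

theorem IsDoubleCastle.exists_guards {D : Set Pt} (hD : IsDoubleCastle D) :
    (reflexEdges D).Finite ∧ ∃ k, (reflexEdges D).ncard = 2 * k + 1 ∧
      ∃ G ⊆ reflexEdges D, G.ncard ≤ k + 1 ∧ GuardedByOpen D G := by
  obtain ⟨C₁, C₂, Q₁, Q₂, B₁, B₂, h₁, hB₁, h₂, hB₂, hB, hDeq⟩ := hD
  obtain ⟨k₁, H₁⟩ := h₁.brickTree hB₁
  obtain ⟨k₂, H₂⟩ := h₂.brickTree hB₂
  have hz : -B₂.lo 2 = B₁.lo 2 := hB.1.1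
  obtain ⟨hQ, hcard⟩ := h₁.primitiveFamily.union h₂.primitiveFamily.turn
    (mem_image_of_mem _ hB₂.1) hB₁.1 hB
    (fun X hX => (H₁.bounds X hX).2.imp_right (B₁.lo_lt_hi 2).trans_le)
    (by
      rintro _ ⟨X, hX, rfl⟩
      exact (H₂.bounds X hX).2.imp (congrArg _)
        fun h => neg_lt_neg ((B₂.lo_lt_hi 2).trans_le h))
  rw [ncard_contacts_turn, h₁.ncard_contacts H₁, h₂.ncard_contacts H₂] at hcard
  have hDQ : D = ⋃ B ∈ Q₁ ∪ Brick.turn '' Q₂, B.solid := by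
    rw [hDeq, biUnion_union, h₁.union_eq, biUnion_image, ← h₂.union_eq, image_iUnion₂]
    simp only [Brick.solid_turn]
  have hD' : D = (⋃ X ∈ Q₁, X.solid) ∪ ⋃ X ∈ Q₂, X.turn.solid := by
    rw [hDQ, biUnion_union, biUnion_image]
  obtain ⟨hfin, hnum⟩ := hQ.ncard_reflexEdges
  have hedge := hQ.mem_reflexEdges_iff
  rw [← hDQ] at hfin hnum hedge
  refine ⟨hfin, k₁ + k₂, by rw [hnum, hcard]; ring, ?_⟩
  have hc₁ := H₁.castle (D := D) (E := reflexEdges D)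
    (fun X hX => by rw [hD']; exact subset_union_of_subset_left (subset_biUnion_of_mem hX) _)
    (fun X hX Y hY h e he => (hedge e).2 ⟨X, Or.inl hX, Y, Or.inl hY, h, he⟩)
  have hc₂ := H₂.castle_turn (D := D) (E := reflexEdges D)
    (fun X hX => by
      rw [hD']
      exact subset_union_of_subset_right
        (subset_biUnion_of_mem (u := fun X : Brick => X.turn.solid) hX) _)
    (fun X hX Y hY h e he => (hedge e).2 ⟨Y.turn, Or.inr (mem_image_of_mem _ hY), X.turn,
      Or.inr (mem_image_of_mem _ hX), h.turn, he⟩)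
  have hbase : ∀ e, IsContactEdge B₂.turn B₁ e → e ∈ reflexEdges D := fun e he =>
    (hedge e).2 ⟨_, Or.inr (mem_image_of_mem _ hB₂.1), _, Or.inl hB₁.1, hB.1, he⟩
  have hs : (-1 : ℝ) * -1 = 1 := by norm_num
  -- `Castle.lit_double` takes the castle with the narrower base first; if that is the turned one,
  -- it is applied with `s = -1`.
  rcases hB.2 with hN | hN
  · obtain ⟨i, j, v, h1, h2, hN, hd⟩ := hN.exists_narrower
    obtain ⟨G, hG, hcG, hlit⟩ := Castle.lit_double _ rfl (one_mul 1) hc₁ hc₂ (by linarith)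
      hd.1 hd.2.1 hd.2.2.1 h1 h2 hN
      (hbase _ ⟨i, j, v, hd, by rw [one_mul, h1, h2, ← hB.1.1]⟩)
    rw [← hD'] at hlit
    exact ⟨G, hG, hcG, hlit.guardedByOpen⟩
  · obtain ⟨i, j, v, h1, h2, hN, hd⟩ := hN.exists_narrower
    rw [← neg_neg (1 : ℝ)] at hc₁
    obtain ⟨G, hG, hcG, hlit⟩ := Castle.lit_double _ rfl hs hc₂ hc₁ (by linarith)
      hd.1 hd.2.1 hd.2.2.1 h1 h2 hN
      (hbase _ ⟨i, j, v, hd.symm, by rw [neg_one_mul]; rfl⟩)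
    rw [union_comm, ← hD'] at hlit
    exact ⟨G, hG, by omega, hlit.guardedByOpen⟩

end OrthoPoly

theorem lemmal4 (D : Set OrthoPoly.Pt) (hD : OrthoPoly.IsDoubleCastle D) :
    (OrthoPoly.reflexEdges D).Finite ∧
    Odd (OrthoPoly.reflexEdges D).ncard ∧
    (∃ G ⊆ OrthoPoly.reflexEdges D,
      G.ncard ≤ (OrthoPoly.reflexEdges D).ncard / 2 + 1 ∧ OrthoPoly.GuardedByClosed D G) ∧
    (∃ G ⊆ OrthoPoly.reflexEdges D,
      G.ncard ≤ (OrthoPoly.reflexEdges D).ncard / 2 + 1 ∧ OrthoPoly.GuardedByOpen D G) := by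
  obtain ⟨hfin, k, hk, G, hG, hcard, hopen⟩ := hD.exists_guards
  have hle : G.ncard ≤ (OrthoPoly.reflexEdges D).ncard / 2 + 1 := by omega
  exact ⟨hfin, ⟨k, hk⟩, ⟨G, hG, hle, hopen.closed⟩, G, hG, hle, hopen⟩
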